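/- **Setting.** Let $\mathcal Q$ be a finite set of $m$ queries with arrival probabilities $p(q)>0$, $\sum_q p(q)=1$, expected serving costs $c(q)\in(0,1]$, and a distance function $d:\mathcal Q\times\mathcal Q\to[0,1]$ with $d(q,q)=0$. For a cache $\mathcal M\subseteq\mathcal Q$ let $$\ell(\mathcal M;p,c,d)=\sum_{q\in\mathcal Q}p(q)\min\{c(q),\,d(q,\mathcal M)\},\qquad d(q,\mathcal M)=\min_{u\in\mathcal M}d(q,u),\quad d(q,\emptyset)=+\infty .$$ Let $\mathcal M^*$ minimize $\ell(\cdot\,;p,c,d)$ among the caches with at most $k$ elements. Let $$\kappa=1-\min_{q}\frac{\ell(\mathcal Q\setminus\{q\};p,c,d)-\ell(\mathcal Q;p,c,d)}{\ell(\emptyset;p,c,d)-\ell(\{q\};p,c,d)}$$ be the curvature, assume $\kappa<1$ (automatic if $d(q,q')>0$ for all $q\ne q'$), and put $\beta=\kappa/(1-\kappa)$, $\alpha=(e^\beta-1)/\beta$ ($\alpha=1$ if $\beta=0$), and $\mathrm{SubOpt}(\mathcal M)=\ell(\mathcal M;p,c,d)-\alpha\,\ell(\mathcal M^*;p,c,d)$.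 **Data.** The dataset consists of records $(\mathcal M_t,q_t,C_t)$, $t=1,\dots,n$, where the pairs $(q_t,C_t)$ are independent over $t$, $\Pr[q_t=q]=p(q)$, $C_t=\emptyset$ means that no cost was observed, $\Pr[C_t\neq\emptyset\mid q_t=q]=\nu(q)>0$, and, given $q_t=q$ and $C_t\ne\emptyset$, the noise $C_t-c(q)$ is zero-mean sub-Gaussian with variance proxy $1/4$ (as for costs in $[0,1]$). **Algorithm (CUCB-SC).** Let $N(q)$ be the number of $t$ with $q_t=q$, and $N_c(q)$ the number of those with $C_t\ne\emptyset$. Put $\hat p(q)=N(q)/n$, let $\hat c(q)$ be the average of the observed costs of $q$, and $$\bar c(q)=\hat c(q)+\sqrt{\frac{\log(6mn/\delta)}{2N_c(q)}},$$ where $\bar c(q)$ is $+\infty$ or any fixed number $\ge1$ if $N_c(q)=0$ (since $d\le1$, the choice does not affect the algorithm). Reverse Greedy starts with $\mathcal Q$ and $m-k$ times (never, if $k\ge m$) removes an element whose removal from the current cache gives the smallest value of $\ell(\cdot\,;\hat p,\bar c,d)$, ties being broken in any way. Let $\hat{\mathcal M}$ be its output. **Theorem.** Let $0<\delta<1$ and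 $n\ge\dfrac{8\log(1/\delta)}{\min_{q}p(q)\nu(q)}$. Then, with probability at least $1-\delta$, every possible output $\hat{\mathcal M}$ of CUCB-SC satisfies $$\mathrm{SubOpt}(\hat{\mathcal M})\le 4\sqrt{\frac{2\sum_{q\in\mathcal Q}\frac1{\nu(q)}\,\log\!\left(\frac{6mn}{\delta}\right)}{n}} .$$ -/

import Mathlib

open MeasureTheory ProbabilityTheory

namespace SemanticCache

noncomputable section

/-- Expected cost of serving `q` with the cache `M` under the optimal decision rule:
`min {c(q), d(q, M)}` with `d(q, M) = min_{u ∈ M} d(q, u)` and `d(q, ∅) = +∞`. -/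
def serveCost {Q : Type*} (c : Q → ℝ) (d : Q → Q → ℝ) (M : Finset Q) (q : Q) : ℝ :=
  open Classical in if h : M.Nonempty then min (c q) (M.inf' h (d q)) else c q

/-- The expected loss `ℓ(M; p, c, d) = ∑_q p(q) min {c(q), d(q, M)}`. -/
def loss {Q : Type*} [Fintype Q] (p c : Q → ℝ) (d : Q → Q → ℝ) (M : Finset Q) : ℝ :=
  ∑ q, p q * serveCost c d M q

/-- `M` is an optimal cache: it minimizes the loss among the caches of size at most `k`. -/
def IsOptimalCache {Q : Type*} [Fintype Q] (p c : Q → ℝ) (d : Q → Q → ℝ) (k : ℕ)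
    (M : Finset Q) : Prop :=
  M.card ≤ k ∧ ∀ M' : Finset Q, M'.card ≤ k → loss p c d M ≤ loss p c d M'

/-- The curvature
`1 - min_q (ℓ(Q \ {q}) - ℓ(Q)) / (ℓ(∅) - ℓ({q}))` of the loss function. -/
def curvature {Q : Type*} [Fintype Q] [DecidableEq Q] (p c : Q → ℝ) (d : Q → Q → ℝ) : ℝ :=
  1 - ⨅ q : Q, (loss p c d (Finset.univ.erase q) - loss p c d Finset.univ) /
    (loss p c d ∅ - loss p c d {q})

/-- The approximation ratio `(e^β - 1) / β`, `β = κ / (1 - κ)`, of reverse greedy for curvature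
`κ < 1`; at `β = 0` it takes its limit value `1`. -/
def approxRatio (κ : ℝ) : ℝ :=
  if κ / (1 - κ) = 0 then 1 else (Real.exp (κ / (1 - κ)) - 1) / (κ / (1 - κ))

/-- `SubOpt(M) = ℓ(M) - α ℓ(M*)`, where `α` is the approximation ratio of reverse greedy for the
loss `ℓ = ℓ(·; p, c, d)` and `Mstar` is an optimal cache. -/
def subOpt {Q : Type*} [Fintype Q] [DecidableEq Q] (p c : Q → ℝ) (d : Q → Q → ℝ)
    (Mstar M : Finset Q) : ℝ :=
  loss p c d M - approxRatio (curvature p c d) * loss p c d Mstar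

/-- `ReverseGreedyRun p c d i M`: starting from the cache of all queries, `M` can be the cache after
`i` iterations of reverse greedy. Each iteration removes an element whose removal gives the smallest
loss; ties may be broken in any way. -/
inductive ReverseGreedyRun {Q : Type*} [Fintype Q] [DecidableEq Q] (p c : Q → ℝ)
    (d : Q → Q → ℝ) : ℕ → Finset Q → Prop
  | init : ReverseGreedyRun p c d 0 Finset.univ
  | step (i : ℕ) (M : Finset Q) (q : Q) (hM : ReverseGreedyRun p c d i M) (hq : q ∈ M)
      (hmin : ∀ q' ∈ M, loss p c d (M.erase q) ≤ loss p c d (M.erase q')) :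
      ReverseGreedyRun p c d (i + 1) (M.erase q)

/-- `M` is a possible output of reverse greedy with cache size `k`: the cache after `m - k`
iterations (none if `k ≥ m`), `m` being the number of queries. -/
def IsReverseGreedyOutput {Q : Type*} [Fintype Q] [DecidableEq Q] (p c : Q → ℝ)
    (d : Q → Q → ℝ) (k : ℕ) (M : Finset Q) : Prop :=
  ReverseGreedyRun p c d (Fintype.card Q - k) M

/-- One record `(M_t, q_t, C_t)` of the offline dataset; `cost = none` means that the query was
answered from the cache, so that no cost was observed. -/
structure Sample (Q : Type*) where
  cache : Finset Q
  query : Q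
  cost : Option ℝ

/-- The number `N(q)` of arrivals of `q`. -/
def arrivalCount {Q : Type*} [DecidableEq Q] {n : ℕ} (D : Fin n → Sample Q) (q : Q) : ℕ :=
  (Finset.univ.filter fun t => (D t).query = q).card

/-- The rounds in which `q` arrived and its cost was observed. -/
def observedRounds {Q : Type*} [DecidableEq Q] {n : ℕ} (D : Fin n → Sample Q) (q : Q) :
    Finset (Fin n) :=
  Finset.univ.filter fun t => (D t).query = q ∧ (D t).cost.isSome = true

/-- The number `N_c(q)` of observed costs of `q`. -/
def costCount {Q : Type*} [DecidableEq Q] {n : ℕ} (D : Fin n → Sample Q) (q : Q) : ℕ :=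
  (observedRounds D q).card

/-- The empirical arrival probability `N(q) / n`. -/
def empArrival {Q : Type*} [DecidableEq Q] {n : ℕ} (D : Fin n → Sample Q) (q : Q) : ℝ :=
  (arrivalCount D q : ℝ) / n

/-- The empirical mean of the observed costs of `q`. -/
def empCost {Q : Type*} [DecidableEq Q] {n : ℕ} (D : Fin n → Sample Q) (q : Q) : ℝ :=
  (∑ t ∈ observedRounds D q, (D t).cost.getD 0) / costCount D q

/-- The upper confidence bound `ĉ(q) + √(log (6mn/δ) / (2 N_c(q)))` of the cost of `q`.
It is `+∞` if `N_c(q) = 0`; there the real number `u` is used. For distances with values in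
`[0, 1]` every `u ≥ 1` gives `min {u, d(q, M)} = d(q, M)` for all nonempty caches `M`, and the empty
cache is only compared with itself, so reverse greedy acts as it does with `+∞`. -/
def ucbCost {Q : Type*} [Fintype Q] [DecidableEq Q] {n : ℕ} (δ u : ℝ)
    (D : Fin n → Sample Q) (q : Q) : ℝ :=
  if costCount D q = 0 then u
  else empCost D q +
    Real.sqrt (Real.log (6 * (Fintype.card Q : ℝ) * n / δ) / (2 * (costCount D q : ℝ)))

/-- `M` is a possible output of the offline algorithm CUCB-SC on the dataset `D`: reverse greedy
run with the empirical arrival probabilities and the upper confidence bounds of the costs. -/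
def IsCUCBSCOutput {Q : Type*} [Fintype Q] [DecidableEq Q] {n : ℕ} (d : Q → Q → ℝ) (k : ℕ)
    (δ u : ℝ) (D : Fin n → Sample Q) (M : Finset Q) : Prop :=
  IsReverseGreedyOutput (empArrival D) (ucbCost δ u D) d k M

/-- `D` is a random offline dataset of `n` independent rounds with arrival probabilities `p`,
expected serving costs `c` and feedback probabilities `ν`. The rounds need not be identically
distributed: the noise and the cache may have a law that changes with `t`. -/
structure IsOfflineDataset {Q : Type*} [MeasurableSpace Q] {Ω : Type*} [MeasurableSpace Ω]
    (P : Measure Ω) {n : ℕ} (p c ν : Q → ℝ) (D : Fin n → Ω → Sample Q) : Prop where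
  /-- The arriving query is a random variable. -/
  measurable_query : ∀ t, Measurable fun ω => (D t ω).query
  /-- The event that the cost is observed is measurable. -/
  measurable_isSome : ∀ t, Measurable fun ω => (D t ω).cost.isSome
  /-- The observed cost is a random variable. -/
  measurable_cost : ∀ t, Measurable fun ω => (D t ω).cost.getD 0
  /-- The pairs `(q_t, C_t)` of different rounds are independent; `C_t` is encoded by whether it is
  observed and by its value (`0` if it is not observed). -/
  indep : iIndepFun
    (fun t ω => ((D t ω).query, ((D t ω).cost.isSome, (D t ω).cost.getD 0))) P
  /-- `Pr[q_t = q] = p(q)`. -/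
  arrival : ∀ t q, P.real {ω | (D t ω).query = q} = p q
  /-- `Pr[C_t ≠ ∅ | q_t = q] = ν(q)`. -/
  feedback : ∀ t q,
    (P[|{ω | (D t ω).query = q}]).real {ω | (D t ω).cost.isSome = true} = ν q
  /-- Given that `q` arrives and its cost is observed, the noise `C_t - c(q)` is (zero-mean)
  sub-Gaussian with variance proxy `1/4`, as for costs in `[0, 1]`. -/
  noise : ∀ t q, HasSubgaussianMGF (fun ω => (D t ω).cost.getD 0 - c q) (1 / 4)
    (P[|{ω | (D t ω).query = q ∧ (D t ω).cost.isSome = true}])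

end

end SemanticCache

/-!
Let `g(M)` be the loss of the cache `M` with the true parameters and `ĝ(M)` the loss that the
algorithm uses. Both are nonincreasing, supermodular and zero at the full cache (`IsRemovalCost`),
and the curvature says that the increment of `g` at any removal of `q` is at most `1 + β` times the
increment at the first one (`loss_increment_le_of_curvature`).

*Reverse greedy with errors.* The classical analysis of reverse greedy on `ĝ` would multiply the
estimation error by the approximation ratio `α`, and would involve the curvature of `ĝ`. Instead,
write `g = f₀ + e` and `ĝ = f₀ + k`, where `f₀` uses the costs `c` and the probabilities
`min (p, p̂)`. Raising the costs changes the loss by a supermodular function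
(`isRemovalCost_loss_sub_loss`), so that `e` and `k` are removal costs again; they are bounded by the
total variation distance `E` of `p` and `p̂`, and by `K = E + ∑ p (c̄ - c)`. Hence the increment of
`ĝ` when all remaining elements outside the optimal cache are removed has two bounds: up to errors,
it is at most `g* + β ĝ(M)`, which leads to the factor `α = (e^β - 1) / β`, and at most `(1 + β) g*`,
which does not grow during the run. Using the first bound during a fraction `s` of the run and the
second one afterwards, a potential argument (`potential`, `ReverseGreedyRun.loss_le`) gives, with
`a = (e^(βs) - 1) / β`,
`g(M̂) ≤ E + a (g* + K + βE) + (1 - s) (K + (1 + β) g*)`.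
For suitable `s`, namely `1` for `β ≤ 3 / 4`, `1 / 2` for `3 / 4 ≤ β ≤ 2`, and `0` for `β = 0` and
`β ≥ 2`, the factor of `g*` is at most `α`, while the factors of `K` and `E` are bounded by absolute
constants (`ReverseGreedyRun.loss_le_of_estimates`).

*Concentration.* Put `L = log (6mn/δ)` and `x = √(∑ 1/ν · L / n)`. A union bound over all sets of
queries with Hoeffding's inequality gives `E ≤ x / 2`. For each possible number of observations of a
query, a Chernoff bound for the compensated noise shows that the empirical cost is within its
confidence radius. Finally `p (min (c̄, 1) - c) ≤ 9 / 4 · √(p / ν) · √(L / n)`: if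
`n p ν` is at most `81 / 16 · L` the left side is small because of the truncation at `1`, which reverse
greedy does not see, and otherwise the number of observations of the query is at least a fixed
fraction of `n p ν`. The sum over the queries is at most `9 / 4 · x` by the Cauchy-Schwarz inequality.
-/

namespace SemanticCache

/-! ### Supermodular removal costs -/

section Greedy

variable {Q : Type*} [Fintype Q] [DecidableEq Q]

/-- A removal cost: a function of the cache that grows when elements are removed, with removal
increments that are larger for smaller caches (supermodularity), normalized to vanish at the cache
of all queries. -/
structure IsRemovalCost (f : Finset Q → ℝ) : Prop where
  antitone : Antitone f
  supermodular : ∀ ⦃M M' : Finset Q⦄ ⦃q : Q⦄, M ⊆ M' → q ∈ M →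
    f (M'.erase q) - f M' ≤ f (M.erase q) - f M
  univ_eq_zero : f Finset.univ = 0

namespace IsRemovalCost

variable {f g : Finset Q → ℝ}

lemma nonneg (hf : IsRemovalCost f) (M : Finset Q) : 0 ≤ f M := by
  rw [← hf.univ_eq_zero]
  exact hf.antitone (Finset.subset_univ M)

lemma increment_nonneg (hf : IsRemovalCost f) (M : Finset Q) (q : Q) :
    0 ≤ f (M.erase q) - f M :=
  sub_nonneg.2 (hf.antitone (Finset.erase_subset q M))

lemma single_le_increment (hf : IsRemovalCost f) {M : Finset Q} {q : Q} (hq : q ∈ M) :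
    f (Finset.univ.erase q) ≤ f (M.erase q) - f M := by
  have := hf.supermodular (Finset.subset_univ M) hq
  rwa [hf.univ_eq_zero, sub_zero] at this

lemma sum_increment_le (hf : IsRemovalCost f) (M : Finset Q) {R : Finset Q} (hR : R ⊆ M) :
    ∑ q ∈ R, (f (M.erase q) - f M) ≤ f (M \ R) - f M := by
  induction R using Finset.induction_on with
  | empty => simp
  | insert a R ha ih =>
    have haM : a ∈ M := hR (Finset.mem_insert_self a R)
    have h1 := ih ((Finset.subset_insert a R).trans hR)
    have h2 : M \ insert a R = (M \ R).erase a := Finset.sdiff_insert M R a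
    have h3 := hf.supermodular (q := a) (Finset.sdiff_subset : M \ R ⊆ M)
      (Finset.mem_sdiff.2 ⟨haM, ha⟩)
    rw [Finset.sum_insert ha, h2]
    linarith

lemma sum_single_le (hf : IsRemovalCost f) (R : Finset Q) :
    ∑ q ∈ R, f (Finset.univ.erase q) ≤ f Rᶜ := by
  have := hf.sum_increment_le Finset.univ (Finset.subset_univ R)
  simpa [hf.univ_eq_zero, Finset.compl_eq_univ_sdiff] using this

lemma add (hf : IsRemovalCost f) (hg : IsRemovalCost g) : IsRemovalCost fun M => f M + g M where
  antitone _ _ h := add_le_add (hf.antitone h) (hg.antitone h)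
  supermodular M M' q h hq := by
    linarith [hf.supermodular h hq, hg.supermodular h hq]
  univ_eq_zero := by simp [hf.univ_eq_zero, hg.univ_eq_zero]

lemma const_mul (hf : IsRemovalCost f) {a : ℝ} (ha : 0 ≤ a) :
    IsRemovalCost fun M => a * f M where
  antitone _ _ h := mul_le_mul_of_nonneg_left (hf.antitone h) ha
  supermodular M M' q h hq := by
    have := mul_le_mul_of_nonneg_left (hf.supermodular h hq) ha
    linarith
  univ_eq_zero := by simp [hf.univ_eq_zero]

lemma sum {ι : Type*} (s : Finset ι) {F : ι → Finset Q → ℝ} (hF : ∀ i, IsRemovalCost (F i)) :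
    IsRemovalCost fun M => ∑ i ∈ s, F i M where
  antitone _ _ h := Finset.sum_le_sum fun i _ => (hF i).antitone h
  supermodular M M' q h hq := by
    rw [← Finset.sum_sub_distrib, ← Finset.sum_sub_distrib]
    exact Finset.sum_le_sum fun i _ => (hF i).supermodular h hq
  univ_eq_zero := Finset.sum_eq_zero fun i _ => (hF i).univ_eq_zero

end IsRemovalCost

end Greedy

/-! ### The potential of a greedy run -/

/-- An upper bound for what reverse greedy can still add to the loss. Here `τ` is the number of
remaining iterations divided by the number of elements that the optimal cache would still remove,
`U` and `W` are two upper bounds for the loss added by removing the latter: `U` never grows along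
the run, `W` can grow at rate `β` times the loss, and `c` is a function growing at least like
`(e^(βx) - 1) / β`. The bound `W` is used while `τ > σ`, the bound `U` from then on. -/
noncomputable def potential (c : ℝ → ℝ) (σ τ U W : ℝ) : ℝ :=
  if τ ≤ σ then τ * U else W * c (τ - σ) + σ * U

section Potential

variable {c : ℝ → ℝ} {β σ : ℝ}

lemma le_growth (h0 : c 0 = 0)
    (hc : ∀ x y, 0 ≤ x → 0 ≤ y → c x + y * (1 + β * c x) ≤ c (x + y)) {x : ℝ} (hx : 0 ≤ x) :
    x ≤ c x := by
  have := hc 0 x le_rfl hx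
  simpa [h0] using this

lemma potential_mono (h0 : c 0 = 0)
    (hc : ∀ x y, 0 ≤ x → 0 ≤ y → c x + y * (1 + β * c x) ≤ c (x + y))
    (hσ : 0 ≤ σ) {τ U W U' W' : ℝ} (hτ : 0 ≤ τ) (hU : U ≤ U') (hW : W ≤ W') :
    potential c σ τ U W ≤ potential c σ τ U' W' := by
  unfold potential
  split_ifs with h
  · exact mul_le_mul_of_nonneg_left hU hτ
  · have := le_growth h0 hc (x := τ - σ) (by linarith)
    have h1 := mul_le_mul_of_nonneg_right hW (show 0 ≤ c (τ - σ) by linarith)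
    have h2 := mul_le_mul_of_nonneg_left hU hσ
    linarith

lemma potential_le_one (h0 : c 0 = 0) (hβ : 0 ≤ β)
    (hc : ∀ x y, 0 ≤ x → 0 ≤ y → c x + y * (1 + β * c x) ≤ c (x + y))
    (hσ1 : σ ≤ 1) {τ U W : ℝ} (hτ1 : τ ≤ 1) (hU : 0 ≤ U) (hW : 0 ≤ W) :
    potential c σ τ U W ≤ W * c (1 - σ) + σ * U := by
  have h1 := le_growth h0 hc (x := 1 - σ) (by linarith)
  unfold potential
  split_ifs with h
  · have := mul_nonneg hW (show 0 ≤ c (1 - σ) by linarith)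
    nlinarith
  · have h2 := le_growth h0 hc (x := τ - σ) (by linarith)
    have h3 := hc (τ - σ) (1 - τ) (by linarith) (by linarith)
    have h4 : 0 ≤ (1 - τ) * (1 + β * c (τ - σ)) :=
      mul_nonneg (by linarith) (by have := mul_nonneg hβ (show 0 ≤ c (τ - σ) by linarith); linarith)
    have h5 : τ - σ + (1 - τ) = 1 - σ := by ring
    rw [h5] at h3
    have := mul_le_mul_of_nonneg_left (show c (τ - σ) ≤ c (1 - σ) by linarith) hW
    linarith

/-- The potential pays for the removal of an element that the optimal cache keeps. Such a removal
leaves the number `N` of elements that the optimal cache would still remove unchanged. -/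
lemma potential_step_of_kept (h0 : c 0 = 0)
    (hc : ∀ x y, 0 ≤ x → 0 ≤ y → c x + y * (1 + β * c x) ≤ c (x + y)) (hβ : 0 ≤ β)
    (hσ : 0 ≤ σ) {N τ U W U' W' δ : ℝ} (hN : 0 < N) (hτ : 0 ≤ τ - 1 / N) (hδ : 0 ≤ δ)
    (hU : N * δ ≤ U) (hW : N * δ ≤ W) (hU' : U' ≤ U) (hW' : W' ≤ W + β * δ) :
    δ + potential c σ (τ - 1 / N) U' W' ≤ potential c σ τ U W := by
  refine (add_le_add_right (potential_mono h0 hc hσ hτ hU' hW') δ).trans ?_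
  have hN' : 0 < 1 / N := by positivity
  have hNN : N * (1 / N) = 1 := by field_simp
  have hW0 : 0 ≤ W := (mul_nonneg hN.le hδ).trans hW
  unfold potential
  generalize 1 / N = z at *
  have hδN : δ = z * (N * δ) := by rw [← mul_assoc, mul_comm z N, hNN, one_mul]
  have hδU : δ ≤ z * U := hδN.le.trans (mul_le_mul_of_nonneg_left hU hN'.le)
  have hδW : δ ≤ z * W := hδN.le.trans (mul_le_mul_of_nonneg_left hW hN'.le)
  split_ifs with h1 h2 h2
  · linarith
  · have h3 := le_growth h0 hc (x := τ - σ) (by linarith)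
    -- Split the step at the point where the bound in use changes.
    have h4 := mul_le_mul_of_nonneg_left h3 hW0
    have h5 : (τ - σ) * (N * δ) ≤ (τ - σ) * W :=
      mul_le_mul_of_nonneg_left hW (by linarith)
    have h6 : (σ - τ + z) * (N * δ) ≤ (σ - τ + z) * U :=
      mul_le_mul_of_nonneg_left hU (by linarith)
    have h7 : (τ - σ) * (N * δ) + (σ - τ + z) * (N * δ) = z * (N * δ) := by ring
    linarith
  · linarith
  · have h3 := le_growth h0 hc (x := τ - z - σ) (by linarith)
    have h4 := hc (τ - z - σ) z (by linarith) hN'.le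
    have h5 : τ - z - σ + z = τ - σ := by ring
    rw [h5] at h4
    have h6 : 0 ≤ 1 + β * c (τ - z - σ) := by
      have := mul_nonneg hβ (show 0 ≤ c (τ - z - σ) by linarith)
      linarith
    have h7 := mul_le_mul_of_nonneg_right hδW h6
    have h8 := mul_le_mul_of_nonneg_left h4 hW0
    linarith

/-- The potential pays for the removal of an element that the optimal cache removes as well. Such a
removal decreases the number `N` of these elements, so that `τ` becomes
`τ' = (N * τ - 1) / (N - 1)`. -/
lemma potential_step_of_removed (h0 : c 0 = 0)
    (hc : ∀ x y, 0 ≤ x → 0 ≤ y → c x + y * (1 + β * c x) ≤ c (x + y)) (hβ : 0 ≤ β)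
    (hσ : 0 ≤ σ) {N τ τ' U W U' W' δ : ℝ} (hN : 1 ≤ N) (hτ0 : 0 ≤ τ') (hτ1 : τ' ≤ 1)
    (hτ : N * τ = 1 + (N - 1) * τ') (hδ : 0 ≤ δ)
    (hU : N * δ ≤ U) (hW : N * δ ≤ W) (hU' : U' ≤ U - δ) (hW' : W' ≤ W - δ) :
    δ + potential c σ τ' U' W' ≤ potential c σ τ U W := by
  refine (add_le_add_right (potential_mono h0 hc hσ hτ0 hU' hW') δ).trans ?_
  have hW0 : 0 ≤ W := (mul_nonneg (by linarith) hδ).trans hW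
  have hττ : N * (τ - τ') = 1 - τ' := by linarith
  have hle : 0 ≤ τ - τ' := by
    by_contra h
    push Not at h
    nlinarith
  have hU1 := mul_le_mul_of_nonneg_left hU hle
  have hW1 := mul_le_mul_of_nonneg_left hW hle
  have hττδ : (τ - τ') * (N * δ) = (1 - τ') * δ := by rw [← hττ]; ring
  unfold potential
  split_ifs with h1 h2 h2
  · linarith
  · have h3 := mul_le_mul_of_nonneg_left (le_growth h0 hc (x := τ - σ) (by linarith)) hW0
    have h4 : (τ - σ) * (N * δ) ≤ (τ - σ) * W := mul_le_mul_of_nonneg_left hW (by linarith)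
    have h5 : (σ - τ') * (N * δ) ≤ (σ - τ') * U := mul_le_mul_of_nonneg_left hU (by linarith)
    have h6 : (τ - σ) * (N * δ) + (σ - τ') * (N * δ) = (τ - τ') * (N * δ) := by ring
    linarith
  · linarith
  · have h3 := le_growth h0 hc (x := τ' - σ) (by linarith)
    have h4 := hc (τ' - σ) (τ - τ') (by linarith) hle
    have h5 : τ' - σ + (τ - τ') = τ - σ := by ring
    rw [h5] at h4
    have h6 : 0 ≤ 1 + β * c (τ' - σ) := by
      have := mul_nonneg hβ (show 0 ≤ c (τ' - σ) by linarith)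
      linarith
    have h7 := mul_le_mul_of_nonneg_right hW1 h6
    have h8 := mul_le_mul_of_nonneg_left h4 hW0
    rw [hττδ] at h7
    -- It remains to see `1 - σ ≤ c (τ' - σ) + (1 - τ') * (1 + β * c (τ' - σ))`.
    have h9 : 0 ≤ (1 - τ') * (β * c (τ' - σ)) :=
      mul_nonneg (by linarith) (mul_nonneg hβ (by linarith))
    have h10 : (1 - σ) * δ ≤ (c (τ' - σ) + (1 - τ') * (1 + β * c (τ' - σ))) * δ :=
      mul_le_mul_of_nonneg_right (by linarith) hδ
    linarith

end Potential

/-! ### Reverse greedy with an inexact objective -/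

section Robust

variable {Q : Type*} [Fintype Q] [DecidableEq Q]

lemma ReverseGreedyRun.card {p c : Q → ℝ} {d : Q → Q → ℝ} {i : ℕ} {M : Finset Q}
    (h : ReverseGreedyRun p c d i M) : M.card + i = Fintype.card Q := by
  induction h with
  | init => simp
  | step i M q hM hq hmin ih =>
    rw [Finset.card_erase_of_mem hq]
    have := Finset.card_pos.2 ⟨q, hq⟩
    omega

/-- Reverse greedy run on `loss p' c' d = f₀ + k`, compared with the optimum `X` of `f₀ + e`, where
`k` and `e` are bounded by `K` and `E` and `f₀ + e` has removal increments at most `1 + β` times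
those at the full cache. The free parameter `σ` is the fraction of the run during which the
increments are bounded by `1 + β` times the optimal loss. -/
theorem ReverseGreedyRun.loss_le {p' c' : Q → ℝ} {d : Q → Q → ℝ} {f₀ k e : Finset Q → ℝ}
    (hf₀ : IsRemovalCost f₀) (hk : IsRemovalCost k) (he : IsRemovalCost e)
    (hl : ∀ M, loss p' c' d M = f₀ M + k M) {β K E : ℝ} (hβ : 0 ≤ β)
    (hK : ∀ M, k M ≤ K) (hE : ∀ M, e M ≤ E)
    (hsteep : ∀ (M : Finset Q), ∀ q ∈ M, f₀ (M.erase q) + e (M.erase q) - (f₀ M + e M) ≤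
      (1 + β) * (f₀ (Finset.univ.erase q) + e (Finset.univ.erase q)))
    {c : ℝ → ℝ} (h0 : c 0 = 0)
    (hc : ∀ x y, 0 ≤ x → 0 ≤ y → c x + y * (1 + β * c x) ≤ c (x + y))
    {σ : ℝ} (hσ : 0 ≤ σ) (hσ1 : σ ≤ 1) {X : Finset Q} {r : ℕ} (hX : X.card + r ≤ Fintype.card Q)
    {M : Finset Q} (hM : ReverseGreedyRun p' c' d r M) :
    f₀ M + e M ≤ E + (f₀ X + e X + K + β * E) * c (1 - σ) +
      σ * ((1 + β) * (f₀ X + e X) + K) := by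
  set U : Finset Q → ℝ := fun M =>
    (1 + β) * ∑ q ∈ M \ X, (f₀ (Finset.univ.erase q) + e (Finset.univ.erase q)) + (K - k M) with hU
  set W : Finset Q → ℝ := fun M =>
    f₀ (M ∩ X) + K - (f₀ M + k M) + β * (E - ∑ q ∈ X \ M, e (Finset.univ.erase q)) with hW
  have hfe := hf₀.add he
  have hfk := hf₀.add hk
  have key : ∀ i M, ReverseGreedyRun p' c' d i M → i ≤ r →
      f₀ M + k M + potential c σ (((r : ℝ) - i) / (M \ X).card) (U M) (W M) ≤
        (f₀ X + e X + K + β * E) * c (1 - σ) + σ * ((1 + β) * (f₀ X + e X) + K) := by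
    intro i M hM
    induction hM with
    | init =>
      intro _
      have hK0 : 0 ≤ K := by simpa [hk.univ_eq_zero] using hK Finset.univ
      have hE0 : 0 ≤ E := by simpa [he.univ_eq_zero] using hE Finset.univ
      have hX0 := hfe.nonneg X
      have heX := he.nonneg X
      beta_reduce at hX0
      have hU0 : U Finset.univ ≤ (1 + β) * (f₀ X + e X) + K := by
        have h1 := hfe.sum_single_le (Finset.univ \ X)
        rw [← Finset.compl_eq_univ_sdiff, compl_compl, Finset.compl_eq_univ_sdiff] at h1
        have h2 := mul_le_mul_of_nonneg_left h1 (show 0 ≤ 1 + β by linarith)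
        simp only [hU, hk.univ_eq_zero]
        linarith
      have hW0 : W Finset.univ ≤ f₀ X + e X + K + β * E := by
        simp only [hW, hk.univ_eq_zero, hf₀.univ_eq_zero, Finset.univ_inter,
          Finset.sdiff_eq_empty_iff_subset.2 (Finset.subset_univ X), Finset.sum_empty]
        linarith
      have hN : (r : ℝ) ≤ (Finset.univ \ X).card := by
        have := Finset.le_card_sdiff X Finset.univ
        rw [Finset.card_univ] at this
        exact_mod_cast (by omega : r ≤ (Finset.univ \ X).card)
      have hτ1 : ((r : ℝ) - (0 : ℕ)) / (Finset.univ \ X).card ≤ 1 :=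
        div_le_one_of_le₀ (by simpa using hN) (by positivity)
      have hτ0 : 0 ≤ ((r : ℝ) - (0 : ℕ)) / (Finset.univ \ X).card := by
        rw [Nat.cast_zero, sub_zero]; positivity
      rw [hf₀.univ_eq_zero, hk.univ_eq_zero, add_zero, zero_add]
      exact (potential_mono h0 hc hσ hτ0 hU0 hW0).trans
        (potential_le_one h0 hβ hc hσ1 hτ1
          (add_nonneg (mul_nonneg (by linarith) hX0) hK0)
          (by have := mul_nonneg hβ hE0; linarith))
    | step i M q hM hq hmin ih =>
      intro hir
      refine le_trans ?_ (ih (by omega))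
      have hcard := hM.card
      have hN1 : r - i ≤ (M \ X).card := by
        have := Finset.le_card_sdiff X M
        omega
      have hNr : (r : ℝ) - i ≤ (M \ X).card := by
        rw [← Nat.cast_sub (by omega)]
        exact_mod_cast hN1
      have hr1 : (1 : ℝ) ≤ (r : ℝ) - i := by
        rw [← Nat.cast_sub (by omega)]
        exact_mod_cast (by omega : 1 ≤ r - i)
      have hNpos : (1 : ℝ) ≤ (M \ X).card := hr1.trans hNr
      obtain ⟨δ, hδ⟩ : ∃ δ, δ = f₀ (M.erase q) + k (M.erase q) - (f₀ M + k M) := ⟨_, rfl⟩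
      have hδ0 : 0 ≤ δ := hδ ▸ hfk.increment_nonneg M q
      have hkq := hk.increment_nonneg M q
      have hsum : (M \ X).card * δ ≤
          ∑ q' ∈ M \ X, (f₀ (M.erase q') + k (M.erase q') - (f₀ M + k M)) := by
        rw [← nsmul_eq_mul]
        refine Finset.card_nsmul_le_sum _ _ _ fun q' hq' => ?_
        have := hmin q' (Finset.mem_sdiff.1 hq').1
        rw [hl, hl] at this
        linarith
      -- Both `U M` and `W M` bound the increments of the elements in `M \ X`.
      have hNU : (M \ X).card * δ ≤ U M := by
        refine hsum.trans ?_
        have h1 : ∑ q' ∈ M \ X, (f₀ (M.erase q') - f₀ M) ≤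
            ∑ q' ∈ M \ X, (1 + β) * (f₀ (Finset.univ.erase q') + e (Finset.univ.erase q')) := by
          refine Finset.sum_le_sum fun q' hq' => ?_
          have h2 := hsteep M q' (Finset.mem_sdiff.1 hq').1
          have h3 := he.increment_nonneg M q'
          linarith
        have h2 := hk.sum_increment_le M (Finset.sdiff_subset (s := M) (t := X))
        have h3 : ∑ q' ∈ M \ X, (f₀ (M.erase q') + k (M.erase q') - (f₀ M + k M)) =
            ∑ q' ∈ M \ X, (f₀ (M.erase q') - f₀ M) + ∑ q' ∈ M \ X, (k (M.erase q') - k M) := by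
          rw [← Finset.sum_add_distrib]
          exact Finset.sum_congr rfl fun _ _ => by ring
        have h4 := hK (M \ (M \ X))
        rw [← Finset.mul_sum] at h1
        simp only [hU]
        linarith
      have hNW : (M \ X).card * δ ≤ W M := by
        refine hsum.trans ?_
        have h1 := hfk.sum_increment_le M (Finset.sdiff_subset (s := M) (t := X))
        have h2 := hK (M ∩ X)
        have h3 := (he.sum_single_le (X \ M)).trans (hE _)
        have h4 := mul_nonneg hβ (sub_nonneg.2 h3)
        rw [sdiff_sdiff_right_self, Finset.inf_eq_inter] at h1
        simp only [hW]
        linarith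
      have hgoal : ∀ τ', δ + potential c σ τ' (U (M.erase q)) (W (M.erase q)) ≤
            potential c σ (((r : ℝ) - i) / (M \ X).card) (U M) (W M) →
          f₀ (M.erase q) + k (M.erase q) + potential c σ τ' (U (M.erase q)) (W (M.erase q)) ≤
            f₀ M + k M + potential c σ (((r : ℝ) - i) / (M \ X).card) (U M) (W M) := by
        intro τ' h
        linarith
      apply hgoal
      by_cases hqX : q ∈ X
      · have hR : M.erase q \ X = M \ X := by
          ext x; simp only [Finset.mem_sdiff, Finset.mem_erase]
          constructor
          · tauto
          · rintro ⟨h1, h2⟩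
            exact ⟨⟨fun h => h2 (h ▸ hqX), h1⟩, h2⟩
        have hI : M.erase q ∩ X = (M ∩ X).erase q := Finset.erase_inter q M X
        have hS : X \ M.erase q = insert q (X \ M) := by
          ext x; simp only [Finset.mem_sdiff, Finset.mem_erase, Finset.mem_insert]
          constructor
          · tauto
          · rintro (rfl | h)
            · exact ⟨hqX, by simp⟩
            · exact ⟨h.1, fun h' => h.2 h'.2⟩
        have hτ : ((r : ℝ) - (i + 1 : ℕ)) / (M \ X).card =
            ((r : ℝ) - i) / (M \ X).card - 1 / (M \ X).card := by
          push_cast; ring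
        rw [hR, hτ]
        refine potential_step_of_kept h0 hc hβ hσ (by linarith) ?_ hδ0 hNU hNW ?_ ?_
        · rw [← sub_div]
          exact div_nonneg (by linarith) (by linarith)
        · simp only [hU, hR]
          linarith
        · have hqI : q ∈ M ∩ X := Finset.mem_inter.2 ⟨hq, hqX⟩
          have h1 := hsteep _ q hqI
          have h2 := he.single_le_increment hqI
          have h3 := hf₀.single_le_increment hq
          have h4 : β * f₀ (Finset.univ.erase q) ≤ β * (f₀ (M.erase q) - f₀ M) :=
            mul_le_mul_of_nonneg_left h3 hβ
          have h5 : β * (f₀ (M.erase q) - f₀ M) ≤ β * δ :=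
            mul_le_mul_of_nonneg_left (by linarith) hβ
          simp only [hW, hI, hS]
          rw [Finset.sum_insert (by simp [hq])]
          linarith
      · have hqR : q ∈ M \ X := Finset.mem_sdiff.2 ⟨hq, hqX⟩
        have hR : M.erase q \ X = (M \ X).erase q := Finset.erase_sdiff_comm M X q
        have hI : M.erase q ∩ X = M ∩ X := by
          ext x; simp only [Finset.mem_inter, Finset.mem_erase]
          constructor
          · tauto
          · rintro ⟨h1, h2⟩
            exact ⟨⟨fun h => hqX (h ▸ h2), h1⟩, h2⟩
        have hS : X \ M.erase q = X \ M := by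
          ext x; simp only [Finset.mem_sdiff, Finset.mem_erase]
          constructor
          · rintro ⟨h1, h2⟩
            exact ⟨h1, fun h => h2 ⟨fun h' => hqX (h' ▸ h1), h⟩⟩
          · tauto
        have hN' : ((M.erase q \ X).card : ℝ) = (M \ X).card - 1 := by
          rw [hR, Finset.card_erase_of_mem hqR, Nat.cast_sub (by exact_mod_cast hNpos),
            Nat.cast_one]
        have hri : (r : ℝ) - (i + 1 : ℕ) = (r : ℝ) - i - 1 := by push_cast; ring
        rw [hN', hri]
        refine potential_step_of_removed h0 hc hβ hσ hNpos
          (div_nonneg (by linarith) (by linarith))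
          (div_le_one_of_le₀ (by linarith) (by linarith)) ?_ hδ0 hNU hNW ?_ ?_
        · rw [mul_div_cancel₀ _ (by linarith)]
          -- For `N = 1` the quotient on the right is `0 / 0 = 0`.
          rcases eq_or_lt_of_le hNpos with h | h
          · rw [← h]; linarith
          · rw [mul_div_cancel₀ _ (by linarith)]; ring
        · have h1 := hsteep M q hq
          have h2 := he.increment_nonneg M q
          have h3 := Finset.add_sum_erase (M \ X)
            (fun q => f₀ (Finset.univ.erase q) + e (Finset.univ.erase q)) hqR
          simp only [hU, hR]
          rw [← h3]
          linarith
        · simp only [hW, hI, hS]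
          linarith
  have hfin := key r M hM le_rfl
  have : potential c σ (((r : ℝ) - r) / (M \ X).card) (U M) (W M) = 0 := by
    simp [potential, hσ]
  have := hk.nonneg M
  have := hE M
  linarith

end Robust

/-! ### The loss as a removal cost -/

section Loss

variable {Q : Type*}

@[simp] lemma serveCost_empty (c : Q → ℝ) (d : Q → Q → ℝ) (q : Q) : serveCost c d ∅ q = c q := by
  simp [serveCost]

lemma serveCost_of_nonempty (c : Q → ℝ) (d : Q → Q → ℝ) {M : Finset Q} (hM : M.Nonempty) (q : Q) :
    serveCost c d M q = min (c q) (M.inf' hM (d q)) := by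
  simp [serveCost, hM]

lemma serveCost_insert [DecidableEq Q] (c : Q → ℝ) (d : Q → Q → ℝ) (M : Finset Q) (u q : Q) :
    serveCost c d (insert u M) q = min (serveCost c d M q) (d q u) := by
  rw [serveCost_of_nonempty c d (Finset.insert_nonempty u M)]
  rcases M.eq_empty_or_nonempty with rfl | hM
  · simp
  · rw [serveCost_of_nonempty c d hM, Finset.inf'_insert hM, min_assoc, min_comm (d q u)]

lemma serveCost_le (c : Q → ℝ) (d : Q → Q → ℝ) (M : Finset Q) (q : Q) :
    serveCost c d M q ≤ c q := by
  rcases M.eq_empty_or_nonempty with rfl | hM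
  · simp
  · rw [serveCost_of_nonempty c d hM]
    exact min_le_left _ _

lemma serveCost_antitone (c : Q → ℝ) (d : Q → Q → ℝ) (q : Q) :
    Antitone fun M => serveCost c d M q := by
  intro M M' h
  beta_reduce
  rcases M.eq_empty_or_nonempty with rfl | hM
  · rw [serveCost_empty]
    exact serveCost_le c d M' q
  · rw [serveCost_of_nonempty c d hM, serveCost_of_nonempty c d (hM.mono h)]
    exact min_le_min le_rfl (Finset.inf'_mono _ h hM)

lemma serveCost_univ [Fintype Q] {c : Q → ℝ} {d : Q → Q → ℝ} (hd : ∀ q q', 0 ≤ d q q')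
    (hd0 : ∀ q, d q q = 0) {q : Q} (hc : 0 ≤ c q) : serveCost c d Finset.univ q = 0 := by
  rw [serveCost_of_nonempty c d ⟨q, Finset.mem_univ q⟩]
  have h1 : Finset.univ.inf' ⟨q, Finset.mem_univ q⟩ (d q) = 0 :=
    le_antisymm ((Finset.inf'_le _ (Finset.mem_univ q)).trans (hd0 q).le)
      (Finset.le_inf' _ _ fun q' _ => hd q q')
  rw [h1, min_eq_right hc]

lemma min_serveCost {c c' : Q → ℝ} (d : Q → Q → ℝ) (M : Finset Q) {q : Q} (h : c q ≤ c' q) :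
    min (c q) (serveCost c' d M q) = serveCost c d M q := by
  rcases M.eq_empty_or_nonempty with rfl | hM
  · simpa using h
  · rw [serveCost_of_nonempty _ d hM, serveCost_of_nonempty _ d hM, ← min_assoc, min_eq_left h]

/-- Costs may be truncated at an upper bound of the distances, as long as the cache is nonempty. -/
lemma serveCost_min_one {c : Q → ℝ} {d : Q → Q → ℝ} (hd : ∀ q q', d q q' ≤ 1) {M : Finset Q}
    (hM : M.Nonempty) (q : Q) :
    serveCost (fun q => min (c q) 1) d M q = serveCost c d M q := by
  rw [serveCost_of_nonempty _ d hM, serveCost_of_nonempty _ d hM, min_assoc]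
  congr 1
  obtain ⟨u, hu⟩ := hM
  exact min_eq_right ((Finset.inf'_le _ hu).trans (hd q u))

variable [Fintype Q] [DecidableEq Q]

/-- A monotone function of a minimum over the cache is supermodular. -/
lemma isRemovalCost_comp_serveCost {c : Q → ℝ} {d : Q → Q → ℝ} (hd : ∀ q q', 0 ≤ d q q')
    (hd0 : ∀ q, d q q = 0) {q : Q} (hc : 0 ≤ c q) {ψ : ℝ → ℝ} (hψ : Monotone ψ) (hψ0 : ψ 0 = 0) :
    IsRemovalCost fun M => ψ (serveCost c d M q) where
  antitone _ _ h := hψ (serveCost_antitone c d q h)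
  supermodular M M' u h hu := by
    have h1 := serveCost_insert c d (M.erase u) u q
    have h2 := serveCost_insert c d (M'.erase u) u q
    rw [Finset.insert_erase hu] at h1
    rw [Finset.insert_erase (h hu)] at h2
    have h3 : serveCost c d (M'.erase u) q ≤ serveCost c d (M.erase u) q :=
      serveCost_antitone c d q (Finset.erase_subset_erase u h)
    rw [h1, h2]
    rcases le_total (serveCost c d (M'.erase u) q) (d q u) with h4 | h4
    · rw [min_eq_left h4, sub_self, sub_nonneg]
      exact hψ (min_le_left _ _)
    · rw [min_eq_right h4, min_eq_right (h4.trans h3)]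
      linarith [hψ h3]
  univ_eq_zero := by rw [serveCost_univ hd hd0 hc, hψ0]

lemma isRemovalCost_loss {p c : Q → ℝ} {d : Q → Q → ℝ} (hp : ∀ q, 0 ≤ p q) (hc : ∀ q, 0 ≤ c q)
    (hd : ∀ q q', 0 ≤ d q q') (hd0 : ∀ q, d q q = 0) : IsRemovalCost (loss p c d) :=
  IsRemovalCost.sum Finset.univ fun q =>
    (isRemovalCost_comp_serveCost hd hd0 (hc q) monotone_id rfl).const_mul (hp q)

/-- Raising the costs changes the loss by a removal cost. -/
lemma isRemovalCost_loss_sub_loss {p c c' : Q → ℝ} {d : Q → Q → ℝ} (hp : ∀ q, 0 ≤ p q)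
    (hc : ∀ q, 0 ≤ c q) (hcc : ∀ q, c q ≤ c' q) (hd : ∀ q q', 0 ≤ d q q')
    (hd0 : ∀ q, d q q = 0) : IsRemovalCost fun M => loss p c' d M - loss p c d M := by
  have h1 : ∀ q, IsRemovalCost fun M => p q * (serveCost c' d M q -
      min (c q) (serveCost c' d M q)) := fun q => by
    refine (isRemovalCost_comp_serveCost (c := c') (ψ := fun x => x - min (c q) x) hd hd0
      ((hc q).trans (hcc q)) ?_ ?_).const_mul (hp q)
    · intro x y hxy
      beta_reduce
      rcases le_total (c q) x with h | h
      · rw [min_eq_left h, min_eq_left (h.trans hxy)]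
        linarith
      · rw [min_eq_right h, sub_self, sub_nonneg]
        exact min_le_right _ _
    · simp [hc q]
  have h2 := IsRemovalCost.sum Finset.univ h1
  have h3 : (fun M => loss p c' d M - loss p c d M) = fun M => ∑ q, p q * (serveCost c' d M q -
      min (c q) (serveCost c' d M q)) := by
    funext M
    rw [loss, loss, ← Finset.sum_sub_distrib]
    refine Finset.sum_congr rfl fun q _ => ?_
    rw [min_serveCost d M (hcc q), mul_sub]
  rwa [h3]

/-- Reverse greedy does not see a truncation of the costs at `1`, unless it empties the cache. -/
lemma ReverseGreedyRun.min_one {p c : Q → ℝ} {d : Q → Q → ℝ} (hd : ∀ q q', d q q' ≤ 1) {i : ℕ}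
    {M : Finset Q} (h : ReverseGreedyRun p c d i M) (hi : i < Fintype.card Q) :
    ReverseGreedyRun p (fun q => min (c q) 1) d i M := by
  have hloss : ∀ M : Finset Q, M.Nonempty →
      loss p (fun q => min (c q) 1) d M = loss p c d M := fun M hM =>
    Finset.sum_congr rfl fun q _ => by rw [serveCost_min_one hd hM]
  induction h with
  | init => exact .init
  | step i M q hM hq hmin ih =>
    refine .step i M q (ih (by omega)) hq fun q' hq' => ?_
    have hcard := hM.card
    have hne : ∀ x ∈ M, (M.erase x).Nonempty := fun x hx => by
      rw [← Finset.card_pos, Finset.card_erase_of_mem hx]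
      omega
    rw [hloss _ (hne q hq), hloss _ (hne q' hq')]
    exact hmin q' hq'

/-! ### Curvature -/

/-- The curvature bounds the growth of the removal increments. -/
lemma loss_increment_le_of_curvature {p c : Q → ℝ} {d : Q → Q → ℝ} (hp : ∀ q, 0 < p q)
    (hc : ∀ q, 0 < c q) (hd : ∀ q q', 0 ≤ d q q') (hd0 : ∀ q, d q q = 0)
    (hκ : curvature p c d < 1) (M : Finset Q) (q : Q) (hq : q ∈ M) :
    loss p c d (M.erase q) - loss p c d M ≤
      (1 + curvature p c d / (1 - curvature p c d)) * loss p c d (Finset.univ.erase q) := by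
  have hf := isRemovalCost_loss (fun q => (hp q).le) (fun q => (hc q).le) hd hd0
  have hκ' : 0 < 1 - curvature p c d := by linarith
  have h1 : loss p c d (M.erase q) - loss p c d M ≤ loss p c d ∅ - loss p c d {q} := by
    have := hf.supermodular (Finset.singleton_subset_iff.2 hq) (Finset.mem_singleton_self q)
    rwa [Finset.erase_singleton] at this
  have h2 : 1 - curvature p c d ≤
      (loss p c d (Finset.univ.erase q) - loss p c d Finset.univ) /
        (loss p c d ∅ - loss p c d {q}) := by
    rw [curvature, sub_sub_cancel]
    exact ciInf_le (Set.finite_range _).bddBelow q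
  have h3 : 0 < loss p c d ∅ - loss p c d {q} := by
    by_contra h
    have h4 := hf.antitone (Finset.empty_subset {q})
    have h5 : loss p c d ∅ - loss p c d {q} = 0 := by linarith
    rw [h5, div_zero] at h2
    linarith
  rw [le_div_iff₀ h3, hf.univ_eq_zero, sub_zero] at h2
  have h6 : 1 + curvature p c d / (1 - curvature p c d) = 1 / (1 - curvature p c d) := by
    field_simp; ring
  rw [h6, one_div, ← div_eq_inv_mul, le_div_iff₀ hκ', mul_comm]
  exact (mul_le_mul_of_nonneg_left h1 hκ'.le).trans h2

lemma curvature_nonneg [Nonempty Q] {p c : Q → ℝ} {d : Q → Q → ℝ} (hp : ∀ q, 0 ≤ p q)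
    (hc : ∀ q, 0 ≤ c q) (hd : ∀ q q', 0 ≤ d q q') (hd0 : ∀ q, d q q = 0) :
    0 ≤ curvature p c d := by
  have hf := isRemovalCost_loss hp hc hd hd0
  obtain ⟨q⟩ := ‹Nonempty Q›
  rw [curvature, sub_nonneg]
  refine (ciInf_le (Set.finite_range _).bddBelow q).trans (div_le_one_of_le₀ ?_ ?_)
  · have := hf.supermodular (Finset.subset_univ {q}) (Finset.mem_singleton_self q)
    rwa [Finset.erase_singleton] at this
  · exact sub_nonneg.2 (hf.antitone (Finset.empty_subset {q}))

end Loss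

/-! ### Numerical estimates for the approximation ratio -/

section Numerics

lemma exp_growth {β : ℝ} (hβ : 0 < β) {x y : ℝ} (_ : 0 ≤ x) (_ : 0 ≤ y) :
    (Real.exp (β * x) - 1) / β + y * (1 + β * ((Real.exp (β * x) - 1) / β)) ≤
      (Real.exp (β * (x + y)) - 1) / β := by
  rw [mul_div_cancel₀ _ hβ.ne', add_sub_cancel, mul_add, Real.exp_add, le_div_iff₀ hβ, add_mul,
    div_mul_cancel₀ _ hβ.ne']
  have := mul_le_mul_of_nonneg_left (Real.add_one_le_exp (β * y)) (Real.exp_pos (β * x)).le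
  linarith

lemma exp_sub_one_le_chord {x b : ℝ} (hx : 0 ≤ x) (hb : 0 < b) (hxb : x ≤ b) :
    Real.exp x - 1 ≤ x * ((Real.exp b - 1) / b) := by
  have h := convexOn_exp.2 (Set.mem_univ 0) (Set.mem_univ b)
    (sub_nonneg.2 ((div_le_one hb).2 hxb)) (div_nonneg hx hb.le) (sub_add_cancel 1 (x / b))
  simp only [smul_eq_mul, mul_zero, zero_add, Real.exp_zero, mul_one,
    div_mul_cancel₀ _ hb.ne'] at h
  have h2 : x * ((Real.exp b - 1) / b) = x / b * Real.exp b - x / b := by ring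
  linarith

lemma one_le_approxRatio {κ : ℝ} (h0 : 0 ≤ κ) (h1 : κ < 1) : 1 ≤ approxRatio κ := by
  unfold approxRatio
  split_ifs with h
  · exact le_rfl
  · have hβ : 0 < κ / (1 - κ) := lt_of_le_of_ne (div_nonneg h0 (by linarith)) (Ne.symm h)
    rw [le_div_iff₀ hβ]
    linarith [Real.add_one_le_exp (κ / (1 - κ))]

lemma half_ratio_le {β : ℝ} (hβ : 3 / 4 ≤ β) :
    (Real.exp (β * (1 - 1 / 2)) - 1) / β + 1 / 2 * (1 + β) ≤ (Real.exp β - 1) / β := by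
  have hβ0 : 0 < β := by linarith
  obtain ⟨z, rfl⟩ : ∃ z, β = 2 * z := ⟨β / 2, by ring⟩
  have h1 : Real.exp (2 * z) = Real.exp z * Real.exp z := by rw [← Real.exp_add]; ring_nf
  have h2 : 2 * z * (1 - 1 / 2) = z := by ring
  have h3 := Real.sum_le_exp_of_nonneg (show 0 ≤ z by linarith) 4
  simp only [Finset.sum_range_succ, Finset.sum_range_zero, Nat.factorial] at h3
  norm_num at h3
  have h4 : 1 + z + z ^ 2 / 2 + z ^ 3 / 6 ≤ Real.exp z := by linarith
  have h5 : z + 2 * z ^ 2 ≤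
      (1 + z + z ^ 2 / 2 + z ^ 3 / 6) * (z + z ^ 2 / 2 + z ^ 3 / 6) := by
    have hz : 0 ≤ z - 3 / 8 := by linarith
    have h6 : (1 + z + z ^ 2 / 2 + z ^ 3 / 6) * (z + z ^ 2 / 2 + z ^ 3 / 6) - (z + 2 * z ^ 2) =
        z ^ 2 * (7 / 6 * z + 7 / 12 * z ^ 2 - 1 / 2) + z ^ 5 / 6 + z ^ 6 / 36 := by ring
    have h7 : 0 ≤ 7 / 6 * z + 7 / 12 * z ^ 2 - 1 / 2 := by nlinarith
    have : 0 ≤ z ^ 2 * (7 / 6 * z + 7 / 12 * z ^ 2 - 1 / 2) + z ^ 5 / 6 + z ^ 6 / 36 := by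
      have : 0 ≤ z := by linarith
      positivity
    linarith
  have h8 : (1 + z + z ^ 2 / 2 + z ^ 3 / 6) * (z + z ^ 2 / 2 + z ^ 3 / 6) ≤
      Real.exp z * (Real.exp z - 1) := by
    have : 0 ≤ z := by linarith
    refine mul_le_mul h4 (by linarith) (by positivity) (Real.exp_pos z).le
  rw [h2, h1, div_add' _ _ _ hβ0.ne', div_le_div_iff_of_pos_right hβ0]
  linarith

lemma one_add_le_ratio {β : ℝ} (hβ : 2 ≤ β) : 1 + β ≤ (Real.exp β - 1) / β := by
  have h3 := Real.sum_le_exp_of_nonneg (show 0 ≤ β by linarith) 5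
  simp only [Finset.sum_range_succ, Finset.sum_range_zero, Nat.factorial] at h3
  norm_num at h3
  rw [le_div_iff₀ (by linarith)]
  have h4 : 0 ≤ β ^ 2 * (β / 6 + β ^ 2 / 24 - 1 / 2) :=
    mul_nonneg (sq_nonneg β) (by nlinarith)
  nlinarith

lemma exp_three_quarters_lt : Real.exp (3 / 4) < 2.118 := by
  have h := Real.exp_bound' (x := 3 / 4) (by norm_num) (by norm_num) (n := 6) (by norm_num)
  simp only [Finset.sum_range_succ, Finset.sum_range_zero, Nat.factorial] at h
  norm_num at h
  norm_num
  linarith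

end Numerics

/-! ### Reverse greedy with estimated probabilities and costs -/

section Deterministic

variable {Q : Type*} [Fintype Q] [DecidableEq Q]

/-- The guarantee of reverse greedy survives estimation errors without being multiplied by the
approximation ratio: if the probabilities are off by at most `x / 2` in total variation and the
costs are overestimated by at most `9 / 4 * x` on average, then the loss exceeds the ratio times the
optimum by less than `4 √2 x`. -/
theorem ReverseGreedyRun.loss_le_of_estimates [Nonempty Q] {p c p' c' : Q → ℝ} {d : Q → Q → ℝ}
    (hp : ∀ q, 0 < p q) (hc : ∀ q, 0 < c q) (hd : ∀ q q', 0 ≤ d q q') (hd0 : ∀ q, d q q = 0)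
    (hκ : curvature p c d < 1) (hp' : ∀ q, 0 ≤ p' q) (hcc : ∀ q, c q ≤ c' q)
    (hc1 : ∀ q, c' q ≤ 1) {x : ℝ} (hE₁ : ∑ q, (p q - min (p q) (p' q)) ≤ x / 2)
    (hE₂ : ∑ q, (p' q - min (p q) (p' q)) ≤ x / 2) (hB : ∑ q, p q * (c' q - c q) ≤ 9 / 4 * x)
    {X : Finset Q} {r : ℕ} (hX : X.card + r ≤ Fintype.card Q) {M : Finset Q}
    (hM : ReverseGreedyRun p' c' d r M) :
    loss p c d M ≤ approxRatio (curvature p c d) * loss p c d X + 5.65 * x := by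
  have hc0 : ∀ q, 0 ≤ c q := fun q => (hc q).le
  have hc'0 : ∀ q, 0 ≤ c' q := fun q => (hc0 q).trans (hcc q)
  set β := curvature p c d / (1 - curvature p c d) with hβdef
  have hκ0 := curvature_nonneg (fun q => (hp q).le) hc0 hd hd0
  have hβ : 0 ≤ β := div_nonneg hκ0 (by linarith)
  have hx : 0 ≤ x := by
    have : 0 ≤ ∑ q, (p q - min (p q) (p' q)) :=
      Finset.sum_nonneg fun q _ => sub_nonneg.2 (min_le_left _ _)
    linarith
  -- The part of the loss that the true and the estimated parameters have in common.
  have hf₀ : IsRemovalCost (loss (fun q => min (p q) (p' q)) c d) :=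
    isRemovalCost_loss (fun q => le_min (hp q).le (hp' q)) hc0 hd hd0
  have he : IsRemovalCost (loss (fun q => p q - min (p q) (p' q)) c d) :=
    isRemovalCost_loss (fun q => sub_nonneg.2 (min_le_left _ _)) hc0 hd hd0
  have hk : IsRemovalCost fun M => loss (fun q => p' q - min (p q) (p' q)) c' d M +
      (loss (fun q => min (p q) (p' q)) c' d M - loss (fun q => min (p q) (p' q)) c d M) :=
    (isRemovalCost_loss (fun q => sub_nonneg.2 (min_le_right _ _)) hc'0 hd hd0).add
      (isRemovalCost_loss_sub_loss (fun q => le_min (hp q).le (hp' q)) hc0 hcc hd hd0)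
  have hfe : ∀ M, loss (fun q => min (p q) (p' q)) c d M +
      loss (fun q => p q - min (p q) (p' q)) c d M = loss p c d M := fun M => by
    simp only [loss, ← Finset.sum_add_distrib]
    exact Finset.sum_congr rfl fun q _ => by ring
  have hl : ∀ M, loss p' c' d M = loss (fun q => min (p q) (p' q)) c d M +
      (loss (fun q => p' q - min (p q) (p' q)) c' d M +
      (loss (fun q => min (p q) (p' q)) c' d M - loss (fun q => min (p q) (p' q)) c d M)) :=
    fun M => by
      rw [add_comm, add_assoc, sub_add_cancel]
      simp only [loss, ← Finset.sum_add_distrib]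
      exact Finset.sum_congr rfl fun q _ => by ring
  have hE : ∀ M, loss (fun q => p q - min (p q) (p' q)) c d M ≤ x / 2 := fun M => by
    refine le_trans (Finset.sum_le_sum fun q _ => ?_) hE₁
    exact mul_le_of_le_one_right (sub_nonneg.2 (min_le_left _ _))
      ((serveCost_le c d M q).trans ((hcc q).trans (hc1 q)))
  have hK : ∀ M, loss (fun q => p' q - min (p q) (p' q)) c' d M +
      (loss (fun q => min (p q) (p' q)) c' d M - loss (fun q => min (p q) (p' q)) c d M) ≤
      11 / 4 * x := fun M => by
    refine (hk.antitone (Finset.empty_subset M)).trans ?_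
    have h1 : loss (fun q => p' q - min (p q) (p' q)) c' d ∅ ≤ x / 2 := by
      refine le_trans (Finset.sum_le_sum fun q _ => ?_) hE₂
      rw [serveCost_empty]
      exact mul_le_of_le_one_right (sub_nonneg.2 (min_le_right _ _)) (hc1 q)
    have h2 : loss (fun q => min (p q) (p' q)) c' d ∅ - loss (fun q => min (p q) (p' q)) c d ∅ ≤
        9 / 4 * x := by
      refine le_trans (le_of_eq_of_le ?_ (Finset.sum_le_sum fun q _ =>
        mul_le_mul_of_nonneg_right (min_le_left (p q) (p' q)) (sub_nonneg.2 (hcc q)))) hB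
      simp only [loss, ← Finset.sum_sub_distrib, serveCost_empty, mul_sub]
    linarith
  have hsteep := loss_increment_le_of_curvature hp hc hd hd0 hκ
  rw [← hβdef] at hsteep
  have hX0 : 0 ≤ loss p c d X := (isRemovalCost_loss (fun q => (hp q).le) hc0 hd hd0).nonneg X
  have main : ∀ g : ℝ → ℝ, g 0 = 0 →
      (∀ x y, 0 ≤ x → 0 ≤ y → g x + y * (1 + β * g x) ≤ g (x + y)) → ∀ σ, 0 ≤ σ → σ ≤ 1 →
      loss p c d M ≤ (g (1 - σ) + σ * (1 + β)) * loss p c d X +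
        (1 / 2 + β * g (1 - σ) / 2 + 11 / 4 * (g (1 - σ) + σ)) * x := by
    intro g hg0 hg σ hσ hσ1
    have := hM.loss_le hf₀ hk he hl hβ hK hE
      (fun M q hq => by rw [hfe, hfe, hfe]; exact hsteep M q hq) hg0 hg hσ hσ1 hX
    rw [hfe, hfe] at this
    linarith
  have hα : approxRatio (curvature p c d) = if β = 0 then 1 else (Real.exp β - 1) / β := rfl
  rw [hα]
  split_ifs with hβ0
  · have := main id rfl (fun x y _ _ => by simp [hβ0]) 1 zero_le_one le_rfl
    simp only [hβ0, sub_self, id] at this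
    linarith
  have hβpos : 0 < β := lt_of_le_of_ne hβ (Ne.symm hβ0)
  have main' := main (fun y => (Real.exp (β * y) - 1) / β) (by simp)
    (fun x y hx hy => exp_growth hβpos hx hy)
  have hfinish : ∀ σ : ℝ, 0 ≤ σ → σ ≤ 1 →
      (Real.exp (β * (1 - σ)) - 1) / β + σ * (1 + β) ≤ (Real.exp β - 1) / β →
      Real.exp (β * (1 - σ)) / 2 + 11 / 4 * ((Real.exp (β * (1 - σ)) - 1) / β + σ) ≤ 5.65 →
      loss p c d M ≤ (Real.exp β - 1) / β * loss p c d X + 5.65 * x := by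
    intro σ hσ hσ1 h1 h2
    have h3 := main' σ hσ hσ1
    have h4 := mul_le_mul_of_nonneg_right h1 hX0
    have h5 := mul_le_mul_of_nonneg_right h2 hx
    have h6 : β * ((Real.exp (β * (1 - σ)) - 1) / β) = Real.exp (β * (1 - σ)) - 1 :=
      mul_div_cancel₀ _ hβ0
    beta_reduce at h3
    rw [h6] at h3
    linarith
  -- The switching time is chosen such that both the optimum and the errors get small factors.
  rcases le_total β (3 / 4) with h | h
  · refine hfinish 0 le_rfl zero_le_one (by simp) ?_
    have h1 := exp_sub_one_le_chord hβ (b := 3 / 4) (by norm_num) h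
    have h2 : (Real.exp β - 1) / β ≤ (Real.exp (3 / 4) - 1) / (3 / 4) := by
      rwa [div_le_iff₀ hβpos, mul_comm]
    have h3 := Real.exp_le_exp.2 h
    have h4 := exp_three_quarters_lt
    rw [sub_zero, mul_one, add_zero]
    have h5 : (Real.exp (3 / 4) - 1) / (3 / 4) = (Real.exp (3 / 4) - 1) * (4 / 3) := by ring
    norm_num at h4 ⊢
    linarith
  rcases le_total β 2 with h' | h'
  · refine hfinish (1 / 2) (by norm_num) (by norm_num) (half_ratio_le h) ?_
    have h0 : β * (1 - 1 / 2) = β / 2 := by ring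
    rw [h0]
    have h1 := exp_sub_one_le_chord (x := β / 2) (by linarith) (b := 1) (by norm_num) (by linarith)
    have h2 : (Real.exp (β / 2) - 1) / β ≤ (Real.exp 1 - 1) / 2 := by
      rw [div_le_iff₀ hβpos]
      linarith
    have h3 := Real.exp_le_exp.2 (show β / 2 ≤ 1 by linarith)
    have h4 := Real.exp_one_lt_d9
    norm_num at h4 ⊢
    linarith
  · refine hfinish 1 zero_le_one le_rfl ?_ ?_
    · simpa using one_add_le_ratio h'
    · norm_num

end Deterministic

/-! ### Exponential tail bounds for the offline dataset -/

section Tail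

variable {Ω : Type*} [MeasurableSpace Ω] {P : Measure Ω}

/-- Chernoff's bound: an independent sum whose terms have exponential moments at most `b`. -/
lemma measureReal_le_sum_le_exp [IsFiniteMeasure P] {n : ℕ} {W : Fin n → Ω → ℝ} (hW : iIndepFun W P)
    (hm : ∀ t, Measurable (W t)) (hi : ∀ t, Integrable (fun ω => Real.exp (W t ω)) P) {b : ℝ}
    (hb : ∀ t, ∫ ω, Real.exp (W t ω) ∂P ≤ b) (a : ℝ) :
    P.real {ω | a ≤ ∑ t, W t ω} ≤ Real.exp (-a) * b ^ n := by
  have h1 : Integrable (fun ω => Real.exp (1 * (∑ t, W t) ω)) P :=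
    hW.integrable_exp_mul_sum hm fun t _ => by simpa using hi t
  have h2 := measure_ge_le_exp_mul_mgf (μ := P) (X := ∑ t, W t) a zero_le_one h1
  rw [hW.mgf_sum hm] at h2
  simp only [Finset.sum_apply, neg_mul, one_mul] at h2
  refine h2.trans (mul_le_mul_of_nonneg_left ?_ (Real.exp_pos _).le)
  have h3 : ∏ t : Fin n, mgf (W t) P 1 ≤ ∏ _t : Fin n, b :=
    Finset.prod_le_prod (fun t _ => mgf_nonneg) fun t _ => by simpa [mgf] using hb t
  simpa using h3

variable {Q : Type*} [MeasurableSpace Q] {n : ℕ} {p c ν : Q → ℝ} {D : Fin n → Ω → Sample Q}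

namespace IsOfflineDataset

/-- A measurable function of the queries and costs gives an independent family. -/
lemma iIndepFun_comp (hD : IsOfflineDataset P p c ν D) {φ : Q × (Bool × ℝ) → ℝ}
    (hφ : Measurable φ) :
    iIndepFun (fun t ω => φ ((D t ω).query, ((D t ω).cost.isSome, (D t ω).cost.getD 0))) P :=
  hD.indep.comp (fun _ => φ) fun _ => hφ

lemma measurable_comp (hD : IsOfflineDataset P p c ν D) {φ : Q × (Bool × ℝ) → ℝ}
    (hφ : Measurable φ) (t : Fin n) :
    Measurable fun ω => φ ((D t ω).query, ((D t ω).cost.isSome, (D t ω).cost.getD 0)) :=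
  hφ.comp ((hD.measurable_query t).prodMk ((hD.measurable_isSome t).prodMk (hD.measurable_cost t)))

variable [MeasurableSingletonClass Q]

lemma measurableSet_query (hD : IsOfflineDataset P p c ν D) (t : Fin n) (q : Q) :
    MeasurableSet {ω | (D t ω).query = q} :=
  hD.measurable_query t (measurableSet_singleton q)

lemma measurableSet_observed (hD : IsOfflineDataset P p c ν D) (t : Fin n) (q : Q) :
    MeasurableSet {ω | (D t ω).query = q ∧ (D t ω).cost.isSome = true} :=
  (hD.measurableSet_query t q).inter (hD.measurable_isSome t (measurableSet_singleton true))

lemma measureReal_observed (hD : IsOfflineDataset P p c ν D) (hp : ∀ q, 0 < p q) (t : Fin n)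
    (q : Q) : P.real {ω | (D t ω).query = q ∧ (D t ω).cost.isSome = true} = p q * ν q := by
  have h1 := hD.feedback t q
  have h2 := hD.arrival t q
  rw [measureReal_def, cond_apply (hD.measurableSet_query t q), ENNReal.toReal_mul,
    ENNReal.toReal_inv, ← measureReal_def, ← measureReal_def, h2] at h1
  rw [← h1, mul_inv_cancel_left₀ (hp q).ne']
  rfl

variable [DecidableEq Q]

lemma measurable_noise (q : Q) (a : ℝ) : Measurable fun x : Q × (Bool × ℝ) =>
    if x.1 = q ∧ x.2.1 = true then a * (x.2.2 - c q) - a ^ 2 / 8 else 0 := by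
  refine Measurable.ite ?_ (by fun_prop) measurable_const
  exact (measurable_fst (measurableSet_singleton q)).inter
    (measurable_snd.fst (measurableSet_singleton true))

variable [IsProbabilityMeasure P]

/-- The compensated noise of the observed costs of `q` in one round has exponential moment at most
one. -/
lemma integral_exp_noise_le (hD : IsOfflineDataset P p c ν D) (t : Fin n) (q : Q) (a : ℝ) :
    Integrable (fun ω => Real.exp (if (D t ω).query = q ∧ (D t ω).cost.isSome = true then
      a * ((D t ω).cost.getD 0 - c q) - a ^ 2 / 8 else 0)) P ∧
    ∫ ω, Real.exp (if (D t ω).query = q ∧ (D t ω).cost.isSome = true then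
      a * ((D t ω).cost.getD 0 - c q) - a ^ 2 / 8 else 0) ∂P ≤ 1 := by
  have hA := hD.measurableSet_observed t q
  have hnoise := hD.noise t q
  set A := {ω | (D t ω).query = q ∧ (D t ω).cost.isSome = true} with hAdef
  set f : Ω → ℝ := fun ω => Real.exp (if (D t ω).query = q ∧ (D t ω).cost.isSome = true then
      a * ((D t ω).cost.getD 0 - c q) - a ^ 2 / 8 else 0) with hf
  have hfA : ∀ ω ∈ A, f ω = Real.exp (-(a ^ 2 / 8)) *
      Real.exp (a * ((D t ω).cost.getD 0 - c q)) := fun ω hω => by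
    rw [hf]
    beta_reduce
    rw [if_pos (show _ ∧ _ from hω), ← Real.exp_add]
    ring_nf
  have hfA' : ∀ ω ∈ Aᶜ, f ω = 1 := fun ω hω => by
    rw [hf]
    beta_reduce
    rw [if_neg (show ¬(_ ∧ _) from hω), Real.exp_zero]
  have hi2 : IntegrableOn f Aᶜ P :=
    (integrableOn_congr_fun hfA' hA.compl).2 (integrable_const 1).integrableOn
  have hint2 : ∫ ω in Aᶜ, f ω ∂P = P.real Aᶜ := by
    rw [setIntegral_congr_fun hA.compl hfA']
    simp
  have h1 : IntegrableOn f A P ∧ ∫ ω in A, f ω ∂P ≤ P.real A := by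
    by_cases hA0 : P A = 0
    · have hr : P.restrict A = 0 := Measure.restrict_eq_zero.2 hA0
      simp [IntegrableOn, hr, measureReal_def, hA0]
    · have hexp := hnoise.integrable_exp_mul a
      rw [ProbabilityTheory.cond, integrable_smul_measure (by simp) (by simpa using hA0)] at hexp
      have hexp' : IntegrableOn (fun ω => Real.exp (-(a ^ 2 / 8)) *
          Real.exp (a * ((D t ω).cost.getD 0 - c q))) A P := hexp.const_mul _
      refine ⟨(integrableOn_congr_fun hfA hA).2 hexp', ?_⟩
      rw [setIntegral_congr_fun hA hfA, integral_const_mul]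
      have hmgf := hnoise.mgf_le a
      rw [mgf, ProbabilityTheory.cond, integral_smul_measure, smul_eq_mul, ENNReal.toReal_inv,
        ← measureReal_def] at hmgf
      have hpos : 0 < P.real A := ENNReal.toReal_pos hA0 (measure_ne_top _ _)
      rw [← div_eq_inv_mul, div_le_iff₀ hpos] at hmgf
      have h8 : ((1 / 4 : NNReal) : ℝ) * a ^ 2 / 2 = a ^ 2 / 8 := by push_cast; ring
      rw [h8] at hmgf
      refine (mul_le_mul_of_nonneg_left hmgf (Real.exp_pos _).le).trans ?_
      rw [← mul_assoc, ← Real.exp_add, neg_add_cancel, Real.exp_zero, one_mul]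
  have hfi : Integrable f P := by
    rw [← integrableOn_univ, ← Set.union_compl_self A]
    exact h1.1.union hi2
  refine ⟨hfi, ?_⟩
  rw [← integral_add_compl hA hfi, hint2, measureReal_compl hA, probReal_univ]
  linarith [h1.2]

/-- For each possible number `s` of observed costs of `q`, the sum of their errors rarely reaches
`√(s L / 2)` in the direction `ε = ± 1`. -/
lemma measureReal_noise_le (hD : IsOfflineDataset P p c ν D) (q : Q) {s : ℕ} (hs : 0 < s) {L : ℝ}
    (hL : 0 ≤ L) {ε : ℝ} (hε : ε ^ 2 = 1) :
    P.real {ω | costCount (fun t => D t ω) q = s ∧ Real.sqrt (s * L / 2) ≤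
      ε * ∑ t ∈ observedRounds (fun t => D t ω) q, ((D t ω).cost.getD 0 - c q)} ≤
      Real.exp (-L) := by
  -- The exponent `a` optimizes Chernoff's bound for this value of `s`.
  set a : ℝ := 4 * Real.sqrt (L / (2 * s)) with ha
  have hs' : (0 : ℝ) < s := by exact_mod_cast hs
  have ha2 : a ^ 2 = 8 * L / s := by
    rw [ha, mul_pow, Real.sq_sqrt (by positivity)]
    field_simp
    ring
  have has : a * Real.sqrt (s * L / 2) = 2 * L := by
    rw [ha, mul_assoc, ← Real.sqrt_mul (by positivity)]
    have : L / (2 * s) * (s * L / 2) = (L / 2) ^ 2 := by field_simp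
    rw [this, Real.sqrt_sq (by positivity)]
    ring
  have h := measureReal_le_sum_le_exp (hD.iIndepFun_comp (measurable_noise (c := c) q (a * ε)))
    (hD.measurable_comp (measurable_noise (c := c) q (a * ε)))
    (fun t => (hD.integral_exp_noise_le t q (a * ε)).1)
    (fun t => (hD.integral_exp_noise_le t q (a * ε)).2) L
  rw [one_pow, mul_one] at h
  refine le_trans (measureReal_mono ?_) h
  rintro ω ⟨h1, h2⟩
  simp only [Set.mem_ofPred_eq]
  rw [← Finset.sum_filter]
  change L ≤ ∑ t ∈ observedRounds (fun t => D t ω) q, _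
  rw [Finset.sum_sub_distrib, Finset.sum_const, ← Finset.mul_sum]
  rw [costCount] at h1
  rw [h1, nsmul_eq_mul, mul_pow, hε, mul_one, ha2]
  have h3 := mul_le_mul_of_nonneg_left h2 (show 0 ≤ a by positivity)
  rw [has] at h3
  have h4 : (s : ℝ) * (8 * L / s / 8) = L := by field_simp
  rw [h4]
  linarith

/-- The cost of `q` is rarely observed much less often than expected. -/
lemma measureReal_costCount_le (hD : IsOfflineDataset P p c ν D) (hp : ∀ q, 0 < p q) (q : Q)
    (a : ℝ) :
    P.real {ω | (costCount (fun t => D t ω) q : ℝ) ≤ a} ≤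
      Real.exp (a - n * (p q * ν q) * (1 - Real.exp (-1))) := by
  have hφ : Measurable fun x : Q × (Bool × ℝ) => if x.1 = q ∧ x.2.1 = true then (-1 : ℝ) else 0 := by
    refine Measurable.ite ?_ measurable_const measurable_const
    exact (measurable_fst (measurableSet_singleton q)).inter
      (measurable_snd.fst (measurableSet_singleton true))
  have hexp : ∀ t, (fun ω => Real.exp (if (D t ω).query = q ∧ (D t ω).cost.isSome = true
      then (-1 : ℝ) else 0)) = fun ω => 1 - Set.indicator
        {ω | (D t ω).query = q ∧ (D t ω).cost.isSome = true} (fun _ => 1 - Real.exp (-1)) ω := by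
    intro t
    funext ω
    by_cases h : (D t ω).query = q ∧ (D t ω).cost.isSome = true
    · rw [if_pos h, Set.indicator_of_mem (by exact h)]
      ring
    · rw [if_neg h, Set.indicator_of_notMem (by exact h)]
      simp
  have hint : ∀ t, Integrable (Set.indicator {ω | (D t ω).query = q ∧ (D t ω).cost.isSome = true}
      (fun _ => 1 - Real.exp (-1))) P := fun t =>
    (integrable_const _).indicator (hD.measurableSet_observed t q)
  have h := measureReal_le_sum_le_exp (hD.iIndepFun_comp hφ) (hD.measurable_comp hφ)
    (b := Real.exp (-(p q * ν q * (1 - Real.exp (-1)))))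
    (fun t => by rw [hexp t]; exact (integrable_const 1).sub (hint t))
    (fun t => by
      rw [hexp t, integral_sub (integrable_const 1) (hint t),
        integral_indicator_const _ (hD.measurableSet_observed t q),
        hD.measureReal_observed hp t q, integral_const, probReal_univ, smul_eq_mul, smul_eq_mul,
        one_mul]
      exact Real.one_sub_le_exp_neg _) (-a)
  refine le_trans (measureReal_mono ?_) (h.trans_eq ?_)
  · intro ω hω
    simp only [Set.mem_ofPred_eq] at hω ⊢
    rw [← Finset.sum_filter]
    change -a ≤ ∑ t ∈ observedRounds (fun t => D t ω) q, _
    rw [Finset.sum_const, nsmul_eq_mul]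
    rw [costCount] at hω
    linarith
  · rw [← Real.exp_nat_mul, ← Real.exp_add]
    ring_nf

/-- Hoeffding's inequality for the empirical arrival probability of a set of queries. -/
lemma measureReal_empArrival_le [Fintype Q] (hD : IsOfflineDataset P p c ν D) (hn : 0 < n) (S : Finset Q)
    {x : ℝ} (hx : 0 ≤ x) :
    P.real {ω | x ≤ ∑ q ∈ S, (empArrival (fun t => D t ω) q - p q)} ≤
      Real.exp (-(2 * n * x ^ 2)) := by
  have hn' : (0 : ℝ) < n := by exact_mod_cast hn
  have hφ' : Measurable fun x : Q × (Bool × ℝ) => if x.1 ∈ S then (1 : ℝ) else 0 := by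
    refine Measurable.ite ?_ measurable_const measurable_const
    exact measurable_fst (Set.toFinite (S : Set Q)).measurableSet
  have hφ : Measurable fun y : Q × (Bool × ℝ) =>
      4 * x * ((if y.1 ∈ S then (1 : ℝ) else 0) - ∑ q ∈ S, p q) :=
    (hφ'.sub_const _).const_mul _
  have hmean : ∀ t, ∫ ω, (if (D t ω).query ∈ S then (1 : ℝ) else 0) ∂P = ∑ q ∈ S, p q := by
    intro t
    have h1 : ∀ ω, (if (D t ω).query ∈ S then (1 : ℝ) else 0) =
        ∑ q ∈ S, Set.indicator {ω | (D t ω).query = q} (fun _ => (1 : ℝ)) ω := by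
      intro ω
      simp [Set.indicator_apply]
    simp_rw [h1]
    rw [integral_finsetSum _ fun q _ =>
      (integrable_const (1 : ℝ)).indicator (hD.measurableSet_query t q)]
    refine Finset.sum_congr rfl fun q _ => ?_
    rw [integral_indicator_const _ (hD.measurableSet_query t q), hD.arrival, smul_eq_mul, mul_one]
  have hsub : ∀ t, HasSubgaussianMGF (fun ω => (if (D t ω).query ∈ S then (1 : ℝ) else 0) -
      ∑ q ∈ S, p q) ((‖(1 : ℝ) - 0‖₊ / 2) ^ 2) P := by
    intro t
    have := hasSubgaussianMGF_of_mem_Icc (μ := P) (a := 0) (b := 1)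
      (hD.measurable_comp hφ' t).aemeasurable (ae_of_all _ fun ω => by split_ifs <;> simp)
    rwa [hmean t] at this
  have h := measureReal_le_sum_le_exp (hD.iIndepFun_comp hφ) (hD.measurable_comp hφ)
    (fun t => (hsub t).integrable_exp_mul (4 * x)) (b := Real.exp (2 * x ^ 2))
    (fun t => by
      refine ((hsub t).mgf_le (4 * x)).trans_eq ?_
      simp
      ring) (4 * n * x ^ 2)
  refine le_trans (measureReal_mono ?_) (h.trans_eq ?_)
  · intro ω hω
    simp only [Set.mem_ofPred_eq] at hω ⊢
    rw [← Finset.mul_sum, Finset.sum_sub_distrib, Finset.sum_const, Finset.card_univ,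
      Fintype.card_fin, nsmul_eq_mul]
    have h1 : ∑ q ∈ S, empArrival (fun t => D t ω) q =
        (∑ t, if (D t ω).query ∈ S then (1 : ℝ) else 0) / n := by
      simp only [empArrival, arrivalCount, Finset.card_filter, Nat.cast_sum, Nat.cast_ite,
        Nat.cast_one, Nat.cast_zero]
      rw [← Finset.sum_div, Finset.sum_comm]
      simp
    rw [Finset.sum_sub_distrib, h1] at hω
    have h2 := mul_le_mul_of_nonneg_left hω (show 0 ≤ 4 * x * n by positivity)
    refine le_trans (le_of_eq (by ring)) (h2.trans_eq ?_)
    field_simp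
  · rw [← Real.exp_nat_mul, ← Real.exp_add]
    ring_nf

end IsOfflineDataset

end Tail

/-! ### Performance on datasets with concentrated estimates -/

section Concentration

variable {Q : Type*} [Fintype Q] {n : ℕ}

/-- One-sided deviations of set probabilities bound both halves of the total variation. -/
lemma sum_sub_min_le {p p' : Q → ℝ} (hp1 : ∑ q, p q = 1) (hp'1 : ∑ q, p' q = 1) {x : ℝ}
    (h : ∀ S : Finset Q, ∑ q ∈ S, (p' q - p q) ≤ x) :
    ∑ q, (p q - min (p q) (p' q)) ≤ x ∧ ∑ q, (p' q - min (p q) (p' q)) ≤ x := by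
  have h1 : ∑ q, (p q - min (p q) (p' q)) = ∑ q, (p' q - min (p q) (p' q)) := by
    rw [Finset.sum_sub_distrib, Finset.sum_sub_distrib, hp1, hp'1]
  have h2 : ∑ q, (p' q - min (p q) (p' q)) ≤ x := by
    refine le_of_eq_of_le ?_ (h (Finset.univ.filter fun q => p q ≤ p' q))
    rw [Finset.sum_filter]
    refine Finset.sum_congr rfl fun q _ => ?_
    split_ifs with hq
    · rw [min_eq_left hq]
    · rw [min_eq_right (le_of_not_ge hq), sub_self]
  exact ⟨h1.trans_le h2, h2⟩

variable [DecidableEq Q]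

lemma sum_empArrival (hn : 0 < n) (D : Fin n → Sample Q) : ∑ q, empArrival D q = 1 := by
  have hn' : (n : ℝ) ≠ 0 := by exact_mod_cast hn.ne'
  simp only [empArrival, arrivalCount, Finset.card_filter, Nat.cast_sum, Nat.cast_ite,
    Nat.cast_one, Nat.cast_zero]
  rw [← Finset.sum_div, Finset.sum_comm]
  simp [hn']

/-- The exploration bonus of the truncated upper confidence bound, weighted with the arrival
probability, is of the order `√(p / ν) √(L / n)`. For rarely observed queries the truncation alone
suffices. -/
lemma mul_sub_le_of_costCount {p c ν L b N : ℝ} (hn : 0 < n) (hp : 0 < p) (hν : 0 < ν)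
    (hc : 0 ≤ c) (hL : 0 < L) (hb1 : b ≤ 1) (hb : 0 < N → b ≤ c + 2 * Real.sqrt (L / (2 * N)))
    (hN : 81 / 16 * L ≤ n * (p * ν) → 32 / 81 * (n * (p * ν)) < N) :
    p * (b - c) ≤ 9 / 4 * (Real.sqrt p * Real.sqrt (1 / ν) * Real.sqrt (L / n)) := by
  have hn' : (0 : ℝ) < n := by exact_mod_cast hn
  have h1 : Real.sqrt p * Real.sqrt (1 / ν) * Real.sqrt (L / n) =
      p * Real.sqrt (L / (n * (p * ν))) := by
    rw [← Real.sqrt_mul hp.le, ← Real.sqrt_mul (by positivity)]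
    have : p * (1 / ν) * (L / n) = p ^ 2 * (L / (n * (p * ν))) := by field_simp
    rw [this, Real.sqrt_mul (by positivity), Real.sqrt_sq hp.le]
  rw [h1, mul_left_comm]
  refine mul_le_mul_of_nonneg_left ?_ hp.le
  have h2 : (9 / 4 : ℝ) = Real.sqrt (81 / 16) := by
    rw [show (81 / 16 : ℝ) = (9 / 4) ^ 2 by norm_num, Real.sqrt_sq (by norm_num)]
  rw [h2, ← Real.sqrt_mul (by norm_num)]
  rcases le_total (81 / 16 * L) (n * (p * ν)) with h | h
  · have hN' := hN h
    have hX : 0 < n * (p * ν) := by positivity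
    have hN0 : 0 < N := lt_trans (by positivity) hN'
    have h3 := hb hN0
    have h4 : (2 : ℝ) * Real.sqrt (L / (2 * N)) = Real.sqrt (2 * L / N) := by
      rw [show (2 : ℝ) = Real.sqrt (2 ^ 2) by rw [Real.sqrt_sq (by norm_num)],
        ← Real.sqrt_mul (by norm_num), Real.sqrt_sq (by norm_num)]
      congr 1
      field_simp
    have h5 : Real.sqrt (2 * L / N) ≤ Real.sqrt (81 / 16 * (L / (n * (p * ν)))) := by
      refine Real.sqrt_le_sqrt ?_
      rw [← mul_div_assoc, div_le_div_iff₀ hN0 hX]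
      have := mul_le_mul_of_nonneg_right hN'.le hL.le
      linarith
    linarith
  · refine le_trans (by linarith : b - c ≤ 1) (Real.one_le_sqrt.2 ?_)
    rwa [← mul_div_assoc, one_le_div (by positivity)]

/-- The suboptimality bound holds for every dataset whose empirical arrival probabilities, average
costs and observation counts are close to their expectations. -/
lemma subOpt_le_of_concentration (hn : 0 < n) {k : ℕ} {δ u : ℝ} (hu : 1 ≤ u)
    {p c ν : Q → ℝ} {d : Q → Q → ℝ} (hp : ∀ q, 0 < p q) (hp1 : ∑ q, p q = 1)
    (hc : ∀ q, 0 < c q ∧ c q ≤ 1) (hν : ∀ q, 0 < ν q) (hν1 : ∀ q, ν q ≤ 1)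
    (hd : ∀ q q', 0 ≤ d q q' ∧ d q q' ≤ 1) (hd0 : ∀ q, d q q = 0) (hκ : curvature p c d < 1)
    {Mstar : Finset Q} (hM : IsOptimalCache p c d k Mstar) {L : ℝ}
    (hLdef : Real.log (6 * (Fintype.card Q : ℝ) * n / δ) = L) (hL : 0 < L) (D : Fin n → Sample Q)
    (harr : ∀ S : Finset Q, ∑ q ∈ S, (empArrival D q - p q) ≤
      Real.sqrt ((Fintype.card Q : ℝ) * L / n) / 2)
    (hnoise : ∀ q, 0 < costCount D q → |∑ t ∈ observedRounds D q, ((D t).cost.getD 0 - c q)| ≤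
      Real.sqrt (costCount D q * L / 2))
    (hcount : ∀ q, 81 / 16 * L ≤ n * (p q * ν q) →
      32 / 81 * (n * (p q * ν q)) < costCount D q)
    {Mhat : Finset Q} (hMhat : IsCUCBSCOutput d k δ u D Mhat) :
    subOpt p c d Mstar Mhat ≤ 4 * Real.sqrt (2 * (∑ q, 1 / ν q) * L / n) := by
  have hn' : (0 : ℝ) < n := by exact_mod_cast hn
  have hne : Nonempty Q := by
    by_contra h
    rw [not_nonempty_iff] at h
    simp at hp1
  have hκ0 := curvature_nonneg (fun q => (hp q).le) (fun q => (hc q).1.le)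
    (fun q q' => (hd q q').1) hd0
  have hS : (Fintype.card Q : ℝ) ≤ ∑ q, 1 / ν q := by
    rw [← Finset.card_univ, ← nsmul_one]
    exact Finset.card_nsmul_le_sum _ _ _ fun q _ => (one_le_div (hν q)).2 (hν1 q)
  have hS0 : 0 ≤ ∑ q, 1 / ν q := le_trans (by positivity) hS
  rw [subOpt, sub_le_iff_le_add']
  rw [IsCUCBSCOutput, IsReverseGreedyOutput] at hMhat
  rcases Nat.eq_zero_or_pos k with rfl | hk
  · -- Only the empty cache is possible.
    have h1 : Mhat = ∅ := by
      rw [← Finset.card_eq_zero]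
      have := hMhat.card
      omega
    have h2 : Mstar = ∅ := Finset.card_eq_zero.1 (Nat.le_zero.1 hM.1)
    rw [h1, h2]
    have h3 := one_le_approxRatio hκ0 hκ
    have h4 := (isRemovalCost_loss (fun q => (hp q).le) (fun q => (hc q).1.le)
      (fun q q' => (hd q q').1) hd0).nonneg ∅
    have h5 := mul_le_mul_of_nonneg_right h3 h4
    have h6 := Real.sqrt_nonneg (2 * (∑ q, 1 / ν q) * L / n)
    linarith
  have hcard : 0 < Fintype.card Q := Fintype.card_pos
  have hrun := hMhat.min_one (fun q q' => (hd q q').2) (by omega)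
  set x : ℝ := Real.sqrt ((∑ q, 1 / ν q) * (L / n)) with hx
  have hxx : Real.sqrt ((Fintype.card Q : ℝ) * L / n) / 2 ≤ x / 2 := by
    rw [mul_div_assoc]
    exact div_le_div_of_nonneg_right (Real.sqrt_le_sqrt
      (mul_le_mul_of_nonneg_right hS (div_pos hL hn').le)) zero_le_two
  have hTV := sum_sub_min_le hp1 (sum_empArrival hn D) fun S => (harr S).trans hxx
  -- With `N` observations, the empirical mean is within the confidence radius `√(L / (2 N))`.
  have hmean : ∀ q, 0 < costCount D q →
      |empCost D q - c q| ≤ Real.sqrt (L / (2 * costCount D q)) := by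
    intro q hq
    have hq' : (0 : ℝ) < costCount D q := by exact_mod_cast hq
    have h1 := hnoise q hq
    have h2 : empCost D q - c q =
        (∑ t ∈ observedRounds D q, ((D t).cost.getD 0 - c q)) / costCount D q := by
      rw [empCost, Finset.sum_sub_distrib, Finset.sum_const, nsmul_eq_mul]
      change _ = (_ - (costCount D q : ℝ) * c q) / _
      field_simp
    have h3 : Real.sqrt (L / (2 * costCount D q)) * costCount D q =
        Real.sqrt (costCount D q * L / 2) := by
      nth_rw 2 [← Real.sqrt_sq hq'.le]
      rw [← Real.sqrt_mul (by positivity)]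
      congr 1
      field_simp
    rw [h2, abs_div, abs_of_pos hq', div_le_iff₀ hq', h3]
    exact h1
  have hucb : ∀ q, 0 < costCount D q → ucbCost δ u D q =
      empCost D q + Real.sqrt (L / (2 * costCount D q)) := fun q hq => by
    rw [ucbCost, if_neg hq.ne', hLdef]
  have hcc : ∀ q, c q ≤ min (ucbCost δ u D q) 1 := by
    intro q
    refine le_min ?_ (hc q).2
    rcases Nat.eq_zero_or_pos (costCount D q) with hq | hq
    · rw [ucbCost, if_pos hq]
      exact (hc q).2.trans hu
    · rw [hucb q hq]
      linarith [(abs_le.1 (hmean q hq)).1]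
  have hB : ∑ q, p q * (min (ucbCost δ u D q) 1 - c q) ≤ 9 / 4 * x := by
    have h1 : ∀ q, p q * (min (ucbCost δ u D q) 1 - c q) ≤
        9 / 4 * (Real.sqrt (p q) * Real.sqrt (1 / ν q) * Real.sqrt (L / n)) := fun q =>
      mul_sub_le_of_costCount hn (hp q) (hν q) (hc q).1.le hL (min_le_right _ _)
        (fun hq => by
          have hq' : 0 < costCount D q := by exact_mod_cast hq
          refine (min_le_left _ _).trans ?_
          rw [hucb q hq']
          linarith [(abs_le.1 (hmean q hq')).2])
        (hcount q)
    refine (Finset.sum_le_sum fun q _ => h1 q).trans ?_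
    rw [← Finset.mul_sum, ← Finset.sum_mul]
    refine mul_le_mul_of_nonneg_left ?_ (by norm_num)
    rw [hx, Real.sqrt_mul hS0]
    refine mul_le_mul_of_nonneg_right ?_ (Real.sqrt_nonneg _)
    have h2 := Real.sum_sqrt_mul_sqrt_le Finset.univ (f := p) (g := fun q => 1 / ν q)
      (fun q => (hp q).le) (fun q => (one_div_pos.2 (hν q)).le)
    rwa [hp1, Real.sqrt_one, one_mul] at h2
  have hX : Mstar.card + (Fintype.card Q - k) ≤ Fintype.card Q := by
    have := hM.1
    have := Finset.card_le_univ Mstar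
    omega
  have hfin := hrun.loss_le_of_estimates hp (fun q => (hc q).1) (fun q q' => (hd q q').1) hd0 hκ
    (fun q => by unfold empArrival; positivity) hcc (fun q => min_le_right _ _) hTV.1 hTV.2 hB hX
  have hsqrt2 : 5.65 ≤ 4 * Real.sqrt 2 := by
    have : (5.65 / 4 : ℝ) ≤ Real.sqrt 2 := Real.le_sqrt_of_sq_le (by norm_num)
    linarith
  have hxfin : 4 * Real.sqrt (2 * (∑ q, 1 / ν q) * L / n) = 4 * Real.sqrt 2 * x := by
    rw [hx, mul_assoc 4, ← Real.sqrt_mul (by norm_num)]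
    ring_nf
  rw [hxfin]
  have := mul_le_mul_of_nonneg_right hsqrt2 (Real.sqrt_nonneg ((∑ q, 1 / ν q) * (L / n)))
  rw [← hx] at this
  linarith

end Concentration

/-! ### Concentration of the estimates -/

namespace IsOfflineDataset

variable {Q : Type*} [Fintype Q] [DecidableEq Q] [MeasurableSpace Q] [MeasurableSingletonClass Q]
  {Ω : Type*} [MeasurableSpace Ω] {P : Measure Ω} [IsProbabilityMeasure P] {n : ℕ}
  {p c ν : Q → ℝ} {D : Fin n → Ω → Sample Q}

/-- A union bound over all sets of queries controls the total variation distance between empirical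
and true arrival probabilities. -/
lemma measureReal_exists_empArrival_le (hD : IsOfflineDataset P p c ν D) (hn : 0 < n)
    (hp1 : ∑ q, p q = 1) {L : ℝ} (hL : Real.log 4 ≤ L) :
    P.real {ω | ∃ S : Finset Q, Real.sqrt ((Fintype.card Q : ℝ) * L / n) / 2 <
      ∑ q ∈ S, (empArrival (fun t => D t ω) q - p q)} ≤
      2 * Fintype.card Q * Real.exp (-L) := by
  have hn' : (0 : ℝ) < n := by exact_mod_cast hn
  have hL0 : 0 ≤ L := (Real.log_nonneg (by norm_num)).trans hL
  rcases Nat.lt_or_ge 1 (Fintype.card Q) with hm | hm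
  · set m := Fintype.card Q with hmdef
    have h1 : {ω | ∃ S : Finset Q, Real.sqrt ((m : ℝ) * L / n) / 2 <
        ∑ q ∈ S, (empArrival (fun t => D t ω) q - p q)} ⊆
        ⋃ S ∈ (Finset.univ : Finset (Finset Q)), {ω | Real.sqrt ((m : ℝ) * L / n) / 2 ≤
        ∑ q ∈ S, (empArrival (fun t => D t ω) q - p q)} := by
      rintro ω ⟨S, hS⟩
      exact Set.mem_biUnion (Finset.mem_univ S) hS.le
    refine ((measureReal_mono h1 (measure_ne_top _ _)).trans (measureReal_biUnion_finset_le _ _)).trans ?_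
    refine (Finset.sum_le_sum fun S _ => hD.measureReal_empArrival_le hn S
      (x := Real.sqrt ((m : ℝ) * L / n) / 2) (by positivity)).trans ?_
    rw [Finset.sum_const, Finset.card_univ, Fintype.card_finset, nsmul_eq_mul, div_pow,
      Real.sq_sqrt (by positivity)]
    have h2 : -(2 * (n : ℝ) * ((m : ℝ) * L / n / 2 ^ 2)) = m * (-(L / 2)) := by
      field_simp
    have h3 : Real.exp (-(L / 2)) ^ 2 = Real.exp (-L) := by
      rw [← Real.exp_nat_mul]
      congr 1
      push_cast
      ring
    have h4 : 2 * Real.exp (-(L / 2)) ≤ 1 := by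
      have h5 : Real.exp (-L) ≤ 1 / 4 := by
        rw [Real.exp_neg, one_div]
        exact inv_anti₀ (by norm_num) ((Real.log_le_iff_le_exp (by norm_num)).1 hL)
      nlinarith [Real.exp_pos (-(L / 2))]
    rw [h2, Real.exp_nat_mul, Nat.cast_pow, Nat.cast_ofNat, ← mul_pow]
    refine (pow_le_pow_of_le_one (by positivity) h4 hm).trans ?_
    rw [mul_pow, h3]
    have h6 : (2 : ℝ) ≤ m := by exact_mod_cast hm
    nlinarith [Real.exp_pos (-L)]
  · -- A single query arrives in every round, so that its empirical probability is exact.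
    have h1 : {ω | ∃ S : Finset Q, Real.sqrt ((Fintype.card Q : ℝ) * L / n) / 2 <
        ∑ q ∈ S, (empArrival (fun t => D t ω) q - p q)} = ∅ := by
      rw [Set.eq_empty_iff_forall_notMem]
      rintro ω ⟨S, hS⟩
      have h2 : ∑ q ∈ S, (empArrival (fun t => D t ω) q - p q) = 0 := by
        have : Subsingleton Q := Fintype.card_le_one_iff_subsingleton.1 hm
        rcases S.eq_empty_or_nonempty with rfl | ⟨q, hq⟩
        · simp
        · have h3 : S = Finset.univ := Finset.eq_univ_of_forall fun q' =>
            Subsingleton.elim q q' ▸ hq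
          rw [h3, Finset.sum_sub_distrib, sum_empArrival hn, hp1, sub_self]
      rw [h2] at hS
      exact absurd hS (not_lt.2 (by positivity))
    rw [h1, measureReal_empty]
    positivity

/-- All empirical costs are within their confidence radii, up to a small probability. -/
lemma measureReal_exists_noise_le (hD : IsOfflineDataset P p c ν D) {L : ℝ} (hL : 0 ≤ L) :
    P.real {ω | ∃ q, 0 < costCount (fun t => D t ω) q ∧
      Real.sqrt (costCount (fun t => D t ω) q * L / 2) <
        |∑ t ∈ observedRounds (fun t => D t ω) q, ((D t ω).cost.getD 0 - c q)|} ≤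
      2 * Fintype.card Q * n * Real.exp (-L) := by
  set B : Q → ℕ → ℝ → Set Ω := fun q s ε => {ω | costCount (fun t => D t ω) q = s ∧
    Real.sqrt (s * L / 2) ≤
      ε * ∑ t ∈ observedRounds (fun t => D t ω) q, ((D t ω).cost.getD 0 - c q)} with hB
  have h1 : {ω | ∃ q, 0 < costCount (fun t => D t ω) q ∧
      Real.sqrt (costCount (fun t => D t ω) q * L / 2) <
        |∑ t ∈ observedRounds (fun t => D t ω) q, ((D t ω).cost.getD 0 - c q)|} ⊆
      ⋃ q ∈ (Finset.univ : Finset Q), ⋃ s ∈ Finset.Icc 1 n, (B q s 1 ∪ B q s (-1)) := by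
    rintro ω ⟨q, hq, h⟩
    have hle : costCount (fun t => D t ω) q ≤ n := by
      simpa [costCount] using Finset.card_le_univ (observedRounds (fun t => D t ω) q)
    refine Set.mem_biUnion (Finset.mem_univ q)
      (Set.mem_biUnion (Finset.mem_coe.2 (Finset.mem_Icc.2 ⟨hq, hle⟩)) ?_)
    rcases le_abs.1 h.le with h' | h'
    · exact Or.inl ⟨rfl, by rwa [one_mul]⟩
    · exact Or.inr ⟨rfl, by rwa [neg_one_mul]⟩
  refine (measureReal_mono h1 (measure_ne_top _ _)).trans ((measureReal_biUnion_finset_le _ _).trans ?_)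
  have h2 : ∀ q, P.real (⋃ s ∈ Finset.Icc 1 n, (B q s 1 ∪ B q s (-1))) ≤
      n * (2 * Real.exp (-L)) := by
    intro q
    refine (measureReal_biUnion_finset_le _ _).trans ?_
    have h3 : ∀ s ∈ Finset.Icc 1 n, P.real (B q s 1 ∪ B q s (-1)) ≤ 2 * Real.exp (-L) := by
      intro s hs
      have hs0 : 0 < s := (Finset.mem_Icc.1 hs).1
      have h4 := hD.measureReal_noise_le q hs0 hL (ε := 1) (by norm_num)
      have h5 := hD.measureReal_noise_le q hs0 hL (ε := -1) (by norm_num)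
      exact (measureReal_union_le _ _).trans (by simp only [hB]; linarith)
    refine (Finset.sum_le_sum h3).trans_eq ?_
    simp
  refine (Finset.sum_le_sum fun q _ => h2 q).trans_eq ?_
  rw [Finset.sum_const, Finset.card_univ, nsmul_eq_mul]
  ring

/-- Every query that is expected to be observed often enough is observed at least `32 / 81` times
as often as expected, up to a small probability. -/
lemma measureReal_exists_costCount_le (hD : IsOfflineDataset P p c ν D) (hp : ∀ q, 0 < p q)
    {L : ℝ} :
    P.real {ω | ∃ q, 81 / 16 * L ≤ n * (p q * ν q) ∧
      (costCount (fun t => D t ω) q : ℝ) ≤ 32 / 81 * (n * (p q * ν q))} ≤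
      Fintype.card Q * Real.exp (-L) := by
  have h1 : {ω | ∃ q, 81 / 16 * L ≤ n * (p q * ν q) ∧
      (costCount (fun t => D t ω) q : ℝ) ≤ 32 / 81 * (n * (p q * ν q))} ⊆
      ⋃ q ∈ (Finset.univ : Finset Q), {ω | 81 / 16 * L ≤ n * (p q * ν q) ∧
        (costCount (fun t => D t ω) q : ℝ) ≤ 32 / 81 * (n * (p q * ν q))} := by
    rintro ω ⟨q, hq⟩
    exact Set.mem_biUnion (Finset.mem_univ q) hq
  refine (measureReal_mono h1 (measure_ne_top _ _)).trans ((measureReal_biUnion_finset_le _ _).trans ?_)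
  rw [← Finset.card_univ, ← nsmul_eq_mul]
  refine Finset.sum_le_card_nsmul _ _ _ fun q _ => ?_
  by_cases hq : 81 / 16 * L ≤ n * (p q * ν q)
  · refine (measureReal_mono fun ω hω => hω.2).trans
      ((hD.measureReal_costCount_le hp q _).trans (Real.exp_le_exp.2 ?_))
    -- `(1 - e⁻¹ - 32 / 81) * (81 / 16) ≥ 1`.
    have h2 : Real.exp (-1) ≤ 0.4 := by
      rw [Real.exp_neg]
      have := Real.exp_one_gt_d9
      exact inv_le_of_inv_le₀ (by norm_num) (by norm_num at this ⊢; linarith)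
    have h0 : 0 ≤ (n : ℝ) * (p q * ν q) := by
      by_cases hn : n = 0
      · simp [hn]
      · have := hD.measureReal_observed hp ⟨0, Nat.pos_of_ne_zero hn⟩ q
        rw [← this]
        positivity
    have h3 := mul_le_mul_of_nonneg_left h2 h0
    linarith
  · have : {ω | 81 / 16 * L ≤ n * (p q * ν q) ∧
        (costCount (fun t => D t ω) q : ℝ) ≤ 32 / 81 * (n * (p q * ν q))} = ∅ :=
      Set.eq_empty_iff_forall_notMem.2 fun ω hω => hq hω.1
    rw [this, measureReal_empty]
    positivity

end IsOfflineDataset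

end SemanticCache

theorem mainTheorem1 {Q : Type*} [Fintype Q] [DecidableEq Q] [MeasurableSpace Q]
    [MeasurableSingletonClass Q] {Ω : Type*} [MeasurableSpace Ω]
    (P : MeasureTheory.Measure Ω) [MeasureTheory.IsProbabilityMeasure P]
    (n k : ℕ) (δ u : ℝ) (hδ0 : 0 < δ) (hδ1 : δ < 1) (hu : 1 ≤ u)
    (p c ν : Q → ℝ) (d : Q → Q → ℝ)
    (hp : ∀ q, 0 < p q) (hp1 : ∑ q, p q = 1)
    (hc : ∀ q, 0 < c q ∧ c q ≤ 1)
    (hν : ∀ q, 0 < ν q)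
    (hd : ∀ q q', 0 ≤ d q q' ∧ d q q' ≤ 1) (hd0 : ∀ q, d q q = 0)
    (hκ : SemanticCache.curvature p c d < 1)
    (D : Fin n → Ω → SemanticCache.Sample Q)
    (hD : SemanticCache.IsOfflineDataset P p c ν D)
    (Mstar : Finset Q) (hM : SemanticCache.IsOptimalCache p c d k Mstar)
    (hn : 8 * Real.log (1 / δ) / (⨅ q, p q * ν q) ≤ (n : ℝ)) :
    1 - δ ≤ P.real {ω | ∀ Mhat : Finset Q,
      SemanticCache.IsCUCBSCOutput d k δ u (fun t => D t ω) Mhat →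
        SemanticCache.subOpt p c d Mstar Mhat ≤
          4 * Real.sqrt (2 * (∑ q, 1 / ν q) *
            Real.log (6 * (Fintype.card Q : ℝ) * n / δ) / n)} := by
  have hne : Nonempty Q := by
    by_contra h
    rw [not_nonempty_iff] at h
    simp at hp1
  -- The sample size condition excludes an empty dataset.
  have hn0 : (0 : ℝ) < n := by
    refine lt_of_lt_of_le (div_pos ?_ ?_) hn
    · exact mul_pos (by norm_num) (Real.log_pos (one_lt_one_div hδ0 hδ1))
    · obtain ⟨q, hq⟩ := exists_eq_ciInf_of_finite (f := fun q => p q * ν q)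
      rw [← hq]
      exact mul_pos (hp q) (hν q)
  have hnpos : 0 < n := by exact_mod_cast hn0
  have hν1 : ∀ q, ν q ≤ 1 := fun q => by
    have h1 := hD.measureReal_observed hp ⟨0, hnpos⟩ q
    have h2 := hD.arrival ⟨0, hnpos⟩ q
    have h3 : P.real {ω | (D ⟨0, hnpos⟩ ω).query = q ∧ (D ⟨0, hnpos⟩ ω).cost.isSome = true} ≤
        P.real {ω | (D ⟨0, hnpos⟩ ω).query = q} := measureReal_mono fun ω hω => hω.1
    rw [h1, h2] at h3
    exact (mul_le_iff_le_one_right (hp q)).1 h3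
  have hm : (1 : ℝ) ≤ Fintype.card Q := by exact_mod_cast Fintype.card_pos (α := Q)
  have hn1 : (1 : ℝ) ≤ n := by exact_mod_cast hnpos
  obtain ⟨L, hL⟩ : ∃ L, Real.log (6 * (Fintype.card Q : ℝ) * n / δ) = L := ⟨_, rfl⟩
  have hmn : 1 ≤ (Fintype.card Q : ℝ) * n := one_le_mul_of_one_le_of_one_le hm hn1
  have hL4 : Real.log 4 ≤ L := by
    rw [← hL]
    refine Real.log_le_log (by norm_num) ?_
    rw [le_div_iff₀ hδ0]
    nlinarith
  have hL0 : 0 < L := (Real.log_pos (by norm_num)).trans_le hL4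
  have hexp : 6 * Fintype.card Q * n * Real.exp (-L) = δ := by
    rw [← hL, Real.exp_neg, Real.exp_log (by positivity)]
    field_simp
  have hB₁ := hD.measureReal_exists_empArrival_le hnpos hp1 hL4
  have hB₂ := hD.measureReal_exists_noise_le hL0.le
  have hB₃ := hD.measureReal_exists_costCount_le hp (L := L)
  set B₁ := {ω | ∃ S : Finset Q, Real.sqrt ((Fintype.card Q : ℝ) * L / n) / 2 <
      ∑ q ∈ S, (SemanticCache.empArrival (fun t => D t ω) q - p q)}
  set B₂ := {ω | ∃ q, 0 < SemanticCache.costCount (fun t => D t ω) q ∧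
      Real.sqrt (SemanticCache.costCount (fun t => D t ω) q * L / 2) <
        |∑ t ∈ SemanticCache.observedRounds (fun t => D t ω) q, ((D t ω).cost.getD 0 - c q)|}
  set B₃ := {ω | ∃ q, 81 / 16 * L ≤ n * (p q * ν q) ∧
      (SemanticCache.costCount (fun t => D t ω) q : ℝ) ≤ 32 / 81 * (n * (p q * ν q))}
  have hbad : P.real (B₁ ∪ B₂ ∪ B₃) ≤ δ := by
    have h1 := measureReal_union_le (μ := P) (B₁ ∪ B₂) B₃
    have h2 := measureReal_union_le (μ := P) B₁ B₂
    have h3 : (Fintype.card Q : ℝ) * Real.exp (-L) ≤ Fintype.card Q * Real.exp (-L) * n :=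
      le_mul_of_one_le_right (by positivity) hn1
    linarith
  rw [hL]
  set G := {ω | ∀ Mhat : Finset Q,
      SemanticCache.IsCUCBSCOutput d k δ u (fun t => D t ω) Mhat →
        SemanticCache.subOpt p c d Mstar Mhat ≤ 4 * Real.sqrt (2 * (∑ q, 1 / ν q) * L / n)}
  have hgood : Set.univ ⊆ (B₁ ∪ B₂ ∪ B₃) ∪ G := by
    intro ω _
    by_cases h : ω ∈ B₁ ∪ B₂ ∪ B₃
    · exact Or.inl h
    · refine Or.inr fun Mhat hMhat => ?_
      simp only [Set.mem_union, not_or] at h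
      obtain ⟨⟨h1, h2⟩, h3⟩ := h
      refine SemanticCache.subOpt_le_of_concentration hnpos hu hp hp1 hc hν hν1 hd hd0 hκ hM hL hL0
        (fun t => D t ω) (fun S => ?_) (fun q hq => ?_) (fun q hq => ?_) hMhat
      · exact not_lt.1 fun h => h1 ⟨S, h⟩
      · exact not_lt.1 fun h => h2 ⟨q, hq, h⟩
      · exact not_le.1 fun h => h3 ⟨q, hq, h⟩
  have huniv := (measureReal_mono (μ := P) hgood).trans (measureReal_union_le _ _)
  rw [probReal_univ] at huniv
  linarith
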